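/- Let $B_R=\{x\in\mathbb R^3:|x|<R\}$. For a vector field $\mathbf u$ on $\mathbb R^3$ put $$\mathbf u_N=\Big(\mathbf u\cdot\frac{x}{|x|}\Big)\frac{x}{|x|},\qquad \mathbf u_T=\mathbf u-\mathbf u_N .$$ Let $\alpha\le 1$ be a real number and let $\mathbf u\in W^{1,3/2}_{\mathrm{loc}}(\mathbb R^3,\mathbb R^3)$ be a weak Beltrami flow, that is, $\operatorname{curl}\mathbf u\times\mathbf u=\mathbf 0$ and $\operatorname{div}\mathbf u=0$ almost everywhere in $\mathbb R^3$, where curl and divergence are formed with the weak derivatives of $\mathbf u$. Then for every $R>0$ the field $\mathbf u$ has a trace on $\partial B_R$, this trace belongs to $L^2(\partial B_R)$, the functions $|\mathbf u|^2/|x|^\alpha$ and $|\mathbf u_N|^2/|x|^\alpha$ are integrable on $B_R$, and $$\frac{\alpha-1}{2}\int_{B_R}\frac{|\mathbf u|^2}{|x|^\alpha}\,dx+\frac R2\int_{\partial B_R}\frac{|\mathbf u|^2}{|x|^\alpha}\,dS =\alpha\int_{B_R}\frac{|\mathbf u_N|^2}{|x|^\alpha}\,dx+R\int_{\partial B_R}\frac{|\mathbf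 u_N|^2}{|x|^\alpha}\,dS .$$ Moreover, if $\alpha=1$, then for every $R>0$ $$\int_{B_R}\frac{|\mathbf u_N|^2}{|x|}\,dx=\frac1{R^2}\int_{B_R}|x|\,|\mathbf u_T|^2\,dx=\frac1{2R}\int_{B_R}|\mathbf u|^2\,dx=\frac12\int_{\partial B_R}\big(|\mathbf u_T|^2-|\mathbf u_N|^2\big)\,dS ,$$ where all the integrands are integrable. In the integrals over $\partial B_R$ the values of $\mathbf u$ are those of its trace, and $dS$ is the surface measure. -/

import Mathlib

open MeasureTheory Filter Topology Metric
open scoped ENNReal ContDiff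

noncomputable section

/-- Three-dimensional Euclidean space. -/
abbrev E3 : Type := EuclideanSpace ℝ (Fin 3)

namespace Beltrami

/-- The standard basis vector `e i`. -/
def e (i : Fin 3) : E3 := EuclideanSpace.single i (1 : ℝ)

/-- The cross product of two vectors. -/
def cross (a b : E3) : E3 := WithLp.toLp 2 (crossProduct a.ofLp b.ofLp)

/-- The divergence `∑ i, ∂ i (u i)` at a point, read off from the derivative `A = Du(x)`,
for which `A (e i) j = ∂ i (u j)`. -/
def divOf (A : E3 →L[ℝ] E3) : ℝ := ∑ i, A (e i) i

/-- The curl at a point, read off from the derivative `A = Du(x)`. -/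
def curlOf (A : E3 →L[ℝ] E3) : E3 :=
  !₂[A (e 1) 2 - A (e 2) 1, A (e 2) 0 - A (e 0) 2, A (e 0) 1 - A (e 1) 0]

/-- `G` is the weak (distributional) derivative of the vector field `u` on the whole space. -/
structure HasWeakDeriv (u : E3 → E3) (G : E3 → (E3 →L[ℝ] E3)) : Prop where
  locallyIntegrable : LocallyIntegrable u volume
  locallyIntegrable_deriv : LocallyIntegrable G volume
  integral_eq : ∀ φ : E3 → ℝ, ContDiff ℝ ∞ φ → HasCompactSupport φ → ∀ v : E3,
    ∫ x, (fderiv ℝ φ x v) • u x = - ∫ x, φ x • G x v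

/-- `f` is in `L^p` on every compact set. -/
def MemLpLoc {F : Type*} [NormedAddCommGroup F] (f : E3 → F) (p : ℝ≥0∞) : Prop :=
  ∀ K : Set E3, IsCompact K → MemLp f p (volume.restrict K)

/-- Weak solutions of `curl u × u = 0`, `div u = 0` on the whole space: `u` belongs to
`W^{1,3/2}_loc`, and its weak derivative satisfies both equations almost everywhere. -/
def IsWeakBeltramiFlow (u : E3 → E3) : Prop :=
  ∃ G : E3 → (E3 →L[ℝ] E3), HasWeakDeriv u G ∧ MemLpLoc u (3 / 2) ∧ MemLpLoc G (3 / 2) ∧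
    (∀ᵐ x, cross (curlOf (G x)) (u x) = 0) ∧ (∀ᵐ x, divOf (G x) = 0)

/-- The surface measure `dS` of the sphere of radius `R` about the origin, as a measure on the
whole space: the surface measure of the unit sphere, transported by `y ↦ R y` and multiplied
by `R ^ 2`. -/
def surfaceMeasure (R : ℝ) : Measure E3 :=
  ENNReal.ofReal (R ^ 2) •
    ((volume : Measure E3).toSphere).map (fun y : sphere (0 : E3) 1 => R • (y : E3))

/-- `g` is the trace on the sphere of radius `R` about the origin of the restriction of `u` to
the ball, in the sense of `W^{1,p}`: `g` is the `L^p`-limit on the sphere of the restrictions of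
smooth vector fields that converge to `u` in `W^{1,p}` of the ball. -/
def IsSphereTrace (p : ℝ≥0∞) (u : E3 → E3) (R : ℝ) (g : E3 → E3) : Prop :=
  MemLp g p (surfaceMeasure R) ∧
  ∃ G : E3 → (E3 →L[ℝ] E3), HasWeakDeriv u G ∧
  ∃ w : ℕ → E3 → E3, (∀ n, ContDiff ℝ ∞ (w n)) ∧
    Tendsto (fun n => eLpNorm (fun x => w n x - u x) p (volume.restrict (ball 0 R)))
      atTop (𝓝 0) ∧
    Tendsto (fun n => eLpNorm (fun x => fderiv ℝ (w n) x - G x) p (volume.restrict (ball 0 R)))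
      atTop (𝓝 0) ∧
    Tendsto (fun n => eLpNorm (fun x => w n x - g x) p (surfaceMeasure R)) atTop (𝓝 0)

/-- The normal part `(u · x/|x|) x/|x|` of a vector field. -/
def normalPart (u : E3 → E3) (x : E3) : E3 :=
  (inner ℝ (u x) (‖x‖⁻¹ • x)) • (‖x‖⁻¹ • x)

/-- The tangential part `u - u_N` of a vector field. -/
def tangentialPart (u : E3 → E3) (x : E3) : E3 := u x - normalPart u x

end Beltrami

end

/-!
With `div u = 0`, the equation `curl u × u = 0` says that the stress tensor `u ⊗ u - ½ |u|² I` is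
divergence free. Testing this with a radial field `m(x) x` on the ball gives, for a smooth radial
weight `m`, an identity between a quadratic integral of `u` over the ball and the integral of
`m R (½ |u_T|² - ½ |u_N|²)` over the sphere. For fields in `W^{1,3/2}` it is obtained from smooth
fields by mollification, since `u ∈ L³` by Sobolev's inequality while `Du ∈ L^{3/2}`. The identity
for `div (|u|² x)`, applied to the differences of the mollified fields, shows that their boundary
values are Cauchy in `L²` of the sphere, so the trace exists in `L²`; Gauss' theorem determines it.

The weight `(|x|² + ε²)^{-1/2}` bounds `∫ |u|² / |x|` as `ε → 0`, and then dominated convergence in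
the weights `(|x|² + ε²)^{-α/2}` gives the identity for every `α ≤ 1`. The three integrals that are
equal for `α = 1` all come from its instances `α = 1, 0, -1`.
-/

noncomputable section

namespace Beltrami

section PolarCoordinates

variable {E F : Type*} [NormedAddCommGroup E] [NormedSpace ℝ E] [FiniteDimensional ℝ E]
  [MeasurableSpace E] [BorelSpace E] [NormedAddCommGroup F] [NormedSpace ℝ F]
  (μ : Measure E) [μ.IsAddHaarMeasure]

/-- The integral of `f` over the sphere of radius `r` about the origin, with respect to the
surface measure that the Haar measure `μ` induces; it is the density of `μ` in the radius. -/
def sphereIntegral (f : E → F) (r : ℝ) : F :=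
  r ^ (Module.finrank ℝ E - 1) • ∫ y, f (r • (y : E)) ∂μ.toSphere

variable {μ} in
lemma integral_eq_integral_sphereIntegral [Nontrivial E] {f : E → F} (hf : Integrable f μ) :
    ∫ x, f x ∂μ = ∫ r in Set.Ioi (0 : ℝ), sphereIntegral μ f r := by
  set n := Module.finrank ℝ E - 1
  have hpres := μ.measurePreserving_homeomorphUnitSphereProd
  have hemb := (homeomorphUnitSphereProd E).measurableEmbedding
  set g : sphere (0 : E) 1 × Set.Ioi (0 : ℝ) → F := fun z => f (z.2.1 • (z.1 : E)) with hg
  have hgf : g ∘ homeomorphUnitSphereProd E = f ∘ ((↑) : ({0}ᶜ : Set E) → E) := by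
    ext x
    simp [hg, smul_smul, norm_ne_zero_iff.2 x.2]
  have hgi : Integrable g (μ.toSphere.prod (Measure.volumeIoiPow n)) := by
    rw [← hpres.integrable_comp_emb hemb, hgf,
      ← integrableOn_iff_comap_subtypeVal (measurableSet_singleton _).compl]
    exact hf.integrableOn
  calc ∫ x, f x ∂μ = ∫ x : ({0}ᶜ : Set E), f x ∂(μ.comap Subtype.val) := by
        rw [integral_subtype_comap (measurableSet_singleton (0 : E)).compl (fun x => f x),
          restrict_compl_singleton]
    _ = ∫ z, g z ∂(μ.toSphere.prod (Measure.volumeIoiPow n)) := by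
        rw [← hpres.integral_comp hemb]
        exact integral_congr_ae (.of_forall fun x => (congrFun hgf x).symm)
    _ = ∫ r, ∫ y, g (y, r) ∂μ.toSphere ∂(Measure.volumeIoiPow n) := integral_prod_symm _ hgi
    _ = ∫ r in Set.Ioi (0 : ℝ), sphereIntegral μ f r := by
        simp only [Measure.volumeIoiPow, ENNReal.ofReal]
        rw [integral_withDensity_eq_integral_smul
            (measurable_subtype_coe.pow_const _).real_toNNReal,
          ← integral_subtype_comap measurableSet_Ioi (sphereIntegral μ f)]
        refine integral_congr_ae (.of_forall fun r => ?_)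
        simp only [hg, NNReal.smul_def, Real.coe_toNNReal _ (pow_nonneg r.2.le _), sphereIntegral,
          n]

lemma setIntegral_ball_eq_integral_sphereIntegral [Nontrivial E] {f : E → F} (hf : Continuous f)
    {R : ℝ} (hR : 0 ≤ R) :
    ∫ x in ball 0 R, f x ∂μ = ∫ r in 0..R, sphereIntegral μ f r := by
  have hfi : Integrable ((ball 0 R).indicator f) μ :=
    ((hf.continuousOn.integrableOn_compact (isCompact_closedBall 0 R)).mono_set
      ball_subset_closedBall).integrable_indicator measurableSet_ball
  rw [← integral_indicator measurableSet_ball, integral_eq_integral_sphereIntegral hfi,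
    intervalIntegral.integral_of_le hR, integral_Ioc_eq_integral_Ioo,
    ← Set.Ioi_inter_Iio, ← setIntegral_indicator measurableSet_Iio]
  refine setIntegral_congr_fun measurableSet_Ioi fun r (hr : 0 < r) => ?_
  by_cases hrR : r < R <;> simp [sphereIntegral, Set.indicator, norm_smul, abs_of_pos hr, hrR]

lemma continuous_sphereIntegral {f : E → F} (hf : Continuous f) :
    Continuous (sphereIntegral μ f) := by
  have hparam : Continuous fun r : ℝ => ∫ y in Set.univ, f (r • (y : E)) ∂μ.toSphere :=
    continuous_parametric_integral_of_continuous (by fun_prop) isCompact_univ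
  simp only [Measure.restrict_univ] at hparam
  exact (continuous_pow _).smul hparam

omit [FiniteDimensional ℝ E] [BorelSpace E] [μ.IsAddHaarMeasure] in
lemma sphereIntegral_smul_norm (w : ℝ → ℝ) (f : E → F) {r : ℝ} (hr : 0 ≤ r) :
    sphereIntegral μ (fun x => w ‖x‖ • f x) r = w r • sphereIntegral μ f r := by
  simp only [sphereIntegral, norm_smul, Real.norm_of_nonneg hr, norm_eq_of_mem_sphere, mul_one,
    integral_smul, smul_comm (w r)]

end PolarCoordinates

section GaussGreen

variable {F : Type*} [NormedAddCommGroup F] [NormedSpace ℝ F] [CompleteSpace F]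

lemma hasDerivAt_integral_sub_sq_smul {a : ℝ → F} (ha : Continuous a) (R : ℝ) :
    HasDerivAt (fun R => ∫ r in 0..R, (R ^ 2 - r ^ 2) • a r) ((2 * R) • ∫ r in 0..R, a r) R := by
  have hsq : Continuous fun r => r ^ 2 • a r := by fun_prop
  have hexpand : (fun R => ∫ r in 0..R, (R ^ 2 - r ^ 2) • a r)
      = fun R => (R ^ 2 • ∫ r in 0..R, a r) - ∫ r in 0..R, r ^ 2 • a r := by
    funext R
    rw [← intervalIntegral.integral_smul, ← intervalIntegral.integral_sub
      (by apply Continuous.intervalIntegrable; fun_prop) (hsq.intervalIntegrable _ _)]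
    simp only [sub_smul]
  rw [hexpand]
  convert ((hasDerivAt_pow 2 R).fun_smul (ha.integral_hasStrictDerivAt 0 R).hasDerivAt).fun_sub
    (hsq.integral_hasStrictDerivAt 0 R).hasDerivAt using 1
  simp

lemma hasDerivAt_integral_sub_sq_sq_smul {a : ℝ → F} (ha : Continuous a) (R : ℝ) :
    HasDerivAt (fun R => ∫ r in 0..R, (R ^ 2 - r ^ 2) ^ 2 • a r)
      ((4 * R) • ∫ r in 0..R, (R ^ 2 - r ^ 2) • a r) R := by
  have hsq : Continuous fun r => r ^ 2 • a r := by fun_prop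
  have hexpand : ∀ R : ℝ, R ^ 2 • (∫ r in 0..R, (R ^ 2 - r ^ 2) • a r)
      - ∫ r in 0..R, (R ^ 2 - r ^ 2) • r ^ 2 • a r = ∫ r in 0..R, (R ^ 2 - r ^ 2) ^ 2 • a r := by
    intro R
    rw [← intervalIntegral.integral_smul, ← intervalIntegral.integral_sub
      (by apply Continuous.intervalIntegrable; fun_prop)
      (by apply Continuous.intervalIntegrable; fun_prop)]
    refine intervalIntegral.integral_congr fun r _ => ?_
    module
  have hmoment : ∫ r in 0..R, (R ^ 2 - r ^ 2) • a r
      = (R ^ 2 • ∫ r in 0..R, a r) - ∫ r in 0..R, r ^ 2 • a r := by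
    rw [← intervalIntegral.integral_smul, ← intervalIntegral.integral_sub
      (by apply Continuous.intervalIntegrable; fun_prop) (hsq.intervalIntegrable _ _)]
    simp only [sub_smul]
  rw [← funext hexpand]
  convert ((hasDerivAt_pow 2 R).fun_smul (hasDerivAt_integral_sub_sq_smul ha R)).fun_sub
    (hasDerivAt_integral_sub_sq_smul hsq R) using 1
  rw [hmoment]
  module

/-- Differentiating twice in `R` removes the weights. -/
lemma smul_integral_eq_of_forall_integral_sub_sq {a b : ℝ → F} (ha : Continuous a)
    (hb : Continuous b) (h : ∀ R > 0, ∫ r in 0..R, (R ^ 2 - r ^ 2) ^ 2 • a r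
      = (4 : ℝ) • ∫ r in 0..R, (R ^ 2 - r ^ 2) • b r) {R : ℝ} (hR : 0 < R) :
    R • ∫ r in 0..R, a r = b R := by
  have hsub : ∀ R > 0, ∫ r in 0..R, (R ^ 2 - r ^ 2) • a r = (2 : ℝ) • ∫ r in 0..R, b r := by
    intro R hR
    have hderiv := (hasDerivAt_integral_sub_sq_sq_smul ha R).congr_of_eventuallyEq
      ((eventually_gt_nhds hR).mono fun R hR => (h R hR).symm)
    have huniq := hderiv.unique ((hasDerivAt_integral_sub_sq_smul hb R).const_smul (4 : ℝ))
    refine smul_right_injective F (mul_pos four_pos hR).ne' ?_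
    simp only [huniq]
    module
  have hderiv := (hasDerivAt_integral_sub_sq_smul ha R).congr_of_eventuallyEq
    ((eventually_gt_nhds hR).mono fun R hR => (hsub R hR).symm)
  have huniq := hderiv.unique ((hb.integral_hasStrictDerivAt 0 R).hasDerivAt.const_smul (2 : ℝ))
  rw [mul_smul] at huniq
  exact smul_right_injective F two_ne_zero huniq

lemma hasDerivAt_max_zero_sq (s : ℝ) :
    HasDerivAt (fun s : ℝ => max 0 s ^ 2) (2 * max 0 s) s := by
  rcases lt_trichotomy s 0 with hs | rfl | hs
  · have hzero : (fun s : ℝ => max 0 s ^ 2) =ᶠ[𝓝 s] fun _ => 0 :=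
      (eventually_lt_nhds hs).mono fun t ht => by simp [max_eq_left ht.le]
    simpa [max_eq_left hs.le] using (hasDerivAt_const s 0).congr_of_eventuallyEq hzero
  · have hbound : (fun s : ℝ => max 0 s ^ 2) =O[𝓝 0] fun s => ‖s - 0‖ ^ 2 := by
      refine .of_bound' (.of_forall fun t => ?_)
      simpa using sq_le_sq' (by linarith [abs_nonneg t, le_max_left 0 t])
        (max_le (abs_nonneg t) (le_abs_self t))
    simpa using (hbound.hasFDerivAt one_lt_two).hasDerivAt
  · have hsq : (fun s : ℝ => max 0 s ^ 2) =ᶠ[𝓝 s] fun s => s ^ 2 :=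
      (eventually_gt_nhds hs).mono fun t ht => by simp [max_eq_right ht.le]
    simpa [max_eq_right hs.le] using (hasDerivAt_pow 2 s).congr_of_eventuallyEq hsq

variable {E : Type*} [NormedAddCommGroup E] [InnerProductSpace ℝ E] [FiniteDimensional ℝ E]
  [MeasurableSpace E] [BorelSpace E]

omit [FiniteDimensional ℝ E] [MeasurableSpace E] [BorelSpace E] in
lemma hasFDerivAt_max_zero_sub_norm_sq (R : ℝ) (x : E) :
    HasFDerivAt (fun x : E => max 0 (R ^ 2 - ‖x‖ ^ 2) ^ 2)
      ((-4 * max 0 (R ^ 2 - ‖x‖ ^ 2)) • innerSL ℝ x) x := by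
  have hcomp := (hasDerivAt_max_zero_sq (R ^ 2 - ‖x‖ ^ 2)).comp_hasFDerivAt x
    ((hasStrictFDerivAt_norm_sq x).hasFDerivAt.const_sub (R ^ 2))
  refine hcomp.congr_fderiv ?_
  module

variable (μ : Measure E) [μ.IsAddHaarMeasure]

omit [InnerProductSpace ℝ E] [FiniteDimensional ℝ E] [μ.IsAddHaarMeasure] [CompleteSpace F] in
lemma setIntegral_ball_sub_norm_sq_pow_smul {k : ℕ} (hk : k ≠ 0) (f : E → F) {R : ℝ}
    (hR : 0 < R) :
    ∫ x in ball 0 R, (R ^ 2 - ‖x‖ ^ 2) ^ k • f x ∂μ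
      = ∫ x, max 0 (R ^ 2 - ‖x‖ ^ 2) ^ k • f x ∂μ := by
  rw [← integral_indicator measurableSet_ball]
  refine integral_congr_ae (.of_forall fun x => ?_)
  by_cases hx : ‖x‖ < R
  · have hmax : 0 ≤ R ^ 2 - ‖x‖ ^ 2 := sub_nonneg.2 (by gcongr)
    simp [hx, hmax]
  · have hmax : R ^ 2 - ‖x‖ ^ 2 ≤ 0 := sub_nonpos.2 (by gcongr; exact not_lt.1 hx)
    simp [hx, hmax, hk]

omit [CompleteSpace F] in
lemma setIntegral_ball_sub_norm_sq_sq_smul_fderiv {f : E → F} (hf : ContDiff ℝ 1 f) (v : E)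
    {R : ℝ} (hR : 0 < R) :
    ∫ x in ball 0 R, (R ^ 2 - ‖x‖ ^ 2) ^ 2 • fderiv ℝ f x v ∂μ
      = (4 : ℝ) • ∫ x in ball 0 R, (R ^ 2 - ‖x‖ ^ 2) • inner ℝ x v • f x ∂μ := by
  have hf' : Continuous fun x => fderiv ℝ f x v :=
    (hf.continuous_fderiv one_ne_zero).clm_apply continuous_const
  have hfc := hf.continuous
  have hint : ∀ {g : E → F}, Continuous g → ∀ {k : ℕ}, k ≠ 0 →
      Integrable (fun x => max 0 (R ^ 2 - ‖x‖ ^ 2) ^ k • g x) μ := by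
    intro g hg k hk
    refine Continuous.integrable_of_hasCompactSupport (by fun_prop)
      (.of_support_subset_isCompact (isCompact_closedBall 0 R) fun x hx => ?_)
    contrapose! hx
    have hxR : R < ‖x‖ := by simpa using hx
    have hmax : R ^ 2 - ‖x‖ ^ 2 ≤ 0 := sub_nonpos.2 (by gcongr)
    simp [hmax, hk]
  have hderiv := hasFDerivAt_max_zero_sub_norm_sq (E := E) R
  have hparts := integral_smul_fderiv_eq_neg_fderiv_smul_of_integrable (μ := μ) (v := v)
    (f := fun x => max 0 (R ^ 2 - ‖x‖ ^ 2) ^ 2) (g := f)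
    (by simpa [(hderiv _).fderiv, mul_smul, mul_assoc] using
      ((hint (g := fun x => inner ℝ x v • f x) (by fun_prop) one_ne_zero).fun_smul (-4 : ℝ)))
    (hint hf' two_ne_zero) (hint hfc two_ne_zero) (fun x _ => (hderiv x).differentiableAt)
    fun x _ => (hf.differentiable one_ne_zero) x
  rw [setIntegral_ball_sub_norm_sq_pow_smul μ two_ne_zero _ hR, hparts, ← integral_neg,
    ← integral_smul]
  have hone := setIntegral_ball_sub_norm_sq_pow_smul μ one_ne_zero
    (fun x => inner ℝ x v • f x) hR
  simp only [pow_one] at hone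
  rw [integral_smul, hone, ← integral_smul]
  refine integral_congr_ae (.of_forall fun x => ?_)
  simp only [(hderiv x).fderiv, smul_apply, innerSL_apply_apply, smul_eq_mul]
  module

/-- The **Gauss–Green formula** on a ball. -/
lemma smul_setIntegral_ball_fderiv [Nontrivial E] {f : E → F} (hf : ContDiff ℝ 1 f) (v : E) {R : ℝ}
    (hR : 0 < R) :
    R • ∫ x in ball 0 R, fderiv ℝ f x v ∂μ
      = sphereIntegral μ (fun x => inner ℝ x v • f x) R := by
  have hf' : Continuous fun x => fderiv ℝ f x v :=
    (hf.continuous_fderiv one_ne_zero).clm_apply continuous_const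
  have hfv : Continuous fun x : E => inner ℝ x v • f x :=
    (continuous_id.inner continuous_const).smul hf.continuous
  rw [setIntegral_ball_eq_integral_sphereIntegral μ hf' hR.le]
  refine smul_integral_eq_of_forall_integral_sub_sq (continuous_sphereIntegral μ hf')
    (continuous_sphereIntegral μ hfv) (fun R hR => ?_) hR
  have hweight : ∀ w : ℝ → ℝ, Continuous w → ∀ g : E → F, Continuous g →
      ∫ x in ball 0 R, w ‖x‖ • g x ∂μ = ∫ r in 0..R, w r • sphereIntegral μ g r := by
    intro w hw g hg
    rw [setIntegral_ball_eq_integral_sphereIntegral μ (by fun_prop) hR.le]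
    refine intervalIntegral.integral_congr fun r hr => ?_
    exact sphereIntegral_smul_norm μ w g ((Set.uIcc_of_le hR.le ▸ hr).1)
  rw [← hweight (fun r => (R ^ 2 - r ^ 2) ^ 2) (by fun_prop) _ hf',
    ← hweight (fun r => R ^ 2 - r ^ 2) (by fun_prop) _ hfv]
  exact setIntegral_ball_sub_norm_sq_sq_smul_fderiv μ hf v hR

/-- The **divergence theorem** on a ball, for the vector field with components `f i` in the
orthonormal basis `b`. -/
lemma smul_setIntegral_ball_sum_fderiv [Nontrivial E] {ι : Type*} [Fintype ι]
    (b : OrthonormalBasis ι ℝ E) {f : ι → E → F} (hf : ∀ i, ContDiff ℝ 1 (f i)) {R : ℝ}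
    (hR : 0 < R) :
    R • ∫ x in ball 0 R, ∑ i, fderiv ℝ (f i) x (b i) ∂μ
      = sphereIntegral μ (fun x => ∑ i, inner ℝ x (b i) • f i x) R := by
  have hball : ∀ i, IntegrableOn (fun x => fderiv ℝ (f i) x (b i)) (ball 0 R) μ := fun i =>
    (((hf i).continuous_fderiv one_ne_zero).clm_apply
      continuous_const).continuousOn.integrableOn_compact (isCompact_closedBall 0 R)
      |>.mono_set ball_subset_closedBall
  have hsphere : ∀ i, Integrable (fun y : sphere (0 : E) 1 =>
      inner ℝ (R • (y : E)) (b i) • f i (R • (y : E))) μ.toSphere := fun i =>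
    have hfc := (hf i).continuous
    Continuous.integrable_of_hasCompactSupport (by fun_prop) (.of_compactSpace _)
  rw [integral_finsetSum _ fun i _ => hball i, Finset.smul_sum,
    Finset.sum_congr rfl fun i _ => smul_setIntegral_ball_fderiv μ (hf i) (b i) hR]
  simp only [sphereIntegral, ← Finset.smul_sum]
  rw [integral_finsetSum _ fun i _ => hsphere i]

lemma setIntegral_ball_finrank_smul_add_fderiv [Nontrivial E] {f : E → F} (hf : ContDiff ℝ 1 f)
    {R : ℝ} (hR : 0 < R) :
    ∫ x in ball 0 R, ((Module.finrank ℝ E : ℝ) • f x + fderiv ℝ f x x) ∂μ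
      = R • sphereIntegral μ f R := by
  set b := stdOrthonormalBasis ℝ E
  have hdiff := hf.differentiable one_ne_zero
  have hdiv : ∀ x, ∑ i, fderiv ℝ (fun x => inner ℝ (b i) x • f x) x (b i)
      = (Module.finrank ℝ E : ℝ) • f x + fderiv ℝ f x x := by
    intro x
    have hterm : ∀ i, fderiv ℝ (fun x => inner ℝ (b i) x • f x) x (b i)
        = f x + fderiv ℝ f x (inner ℝ (b i) x • b i) := fun i => by
      have hcoord : HasFDerivAt (fun x => inner ℝ (b i) x) (innerSL ℝ (b i)) x :=
        (innerSL ℝ (b i)).hasFDerivAt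
      simp [(hcoord.fun_smul (hdiff x).hasFDerivAt).fderiv, add_comm]
    rw [Finset.sum_congr rfl fun i _ => hterm i, Finset.sum_add_distrib, ← map_sum, b.sum_repr']
    simp [Nat.cast_smul_eq_nsmul]
  have hflux : ∀ x, ∑ i, inner ℝ x (b i) • inner ℝ (b i) x • f x = ‖x‖ ^ 2 • f x := fun x => by
    simp_rw [smul_smul, ← Finset.sum_smul, b.sum_inner_mul_inner, real_inner_self_eq_norm_sq]
  have hgg := smul_setIntegral_ball_sum_fderiv μ b (f := fun i x => inner ℝ (b i) x • f x)
    (fun i => (contDiff_const.inner ℝ contDiff_id).smul hf) hR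
  simp only [hdiv, hflux] at hgg
  rw [sphereIntegral_smul_norm μ (fun r => r ^ 2) f hR.le, sq, mul_smul] at hgg
  exact smul_right_injective F hR.ne' hgg

end GaussGreen

section SurfaceMeasure

lemma measurableEmbedding_smul_sphere {R : ℝ} (hR : 0 < R) :
    MeasurableEmbedding (fun y : sphere (0 : E3) 1 => R • (y : E3)) :=
  (Homeomorph.smulOfNeZero R hR.ne').measurableEmbedding.comp
    (MeasurableEmbedding.subtype_coe isClosed_sphere.measurableSet)

lemma integral_surfaceMeasure {F : Type*} [NormedAddCommGroup F] [NormedSpace ℝ F]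
    {R : ℝ} (hR : 0 < R) (f : E3 → F) :
    ∫ x, f x ∂(surfaceMeasure R) = sphereIntegral volume f R := by
  rw [surfaceMeasure, integral_smul_measure, (measurableEmbedding_smul_sphere hR).integral_map,
    ENNReal.toReal_ofReal (by positivity), sphereIntegral, finrank_euclideanSpace_fin]

instance isFiniteMeasure_surfaceMeasure (R : ℝ) : IsFiniteMeasure (surfaceMeasure R) :=
  Measure.smul_finite _ ENNReal.ofReal_ne_top

lemma ae_surfaceMeasure_norm_eq {R : ℝ} (hR : 0 < R) : ∀ᵐ x ∂(surfaceMeasure R), ‖x‖ = R := by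
  refine Measure.ae_smul_measure ?_ _
  rw [(measurableEmbedding_smul_sphere hR).ae_map_iff]
  exact .of_forall fun y => by simp [norm_smul, abs_of_pos hR]

lemma ae_surfaceMeasure_norm_le {R : ℝ} (hR : 0 < R) : ∀ᵐ x ∂(surfaceMeasure R), ‖x‖ ≤ R :=
  (ae_surfaceMeasure_norm_eq hR).mono fun _ hx => hx.le

end SurfaceMeasure

section Divergence

/-- `divOf` as a continuous linear functional. -/
def divCLM : (E3 →L[ℝ] E3) →L[ℝ] ℝ :=
  ∑ i, (EuclideanSpace.proj i).comp (ContinuousLinearMap.apply ℝ E3 (e i))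

lemma divCLM_apply (A : E3 →L[ℝ] E3) : divCLM A = divOf A := by
  simp [divCLM, divOf]

lemma sum_smul_e (w : E3) : ∑ i, w i • e i = w := by
  simpa [e] using (EuclideanSpace.basisFun (Fin 3) ℝ).sum_repr w

lemma divOf_smulRight (L : E3 →L[ℝ] ℝ) (w : E3) : divOf (L.smulRight w) = L w := by
  conv_rhs => rw [← sum_smul_e w]
  simp [divOf, mul_comm]

lemma divOf_id : divOf (ContinuousLinearMap.id ℝ E3) = 3 := by
  simp [divOf, e]

lemma divOf_fderiv_smul {f : E3 → ℝ} {v : E3 → E3} {f' : E3 →L[ℝ] ℝ} {v' : E3 →L[ℝ] E3} {x : E3}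
    (hf : HasFDerivAt f f' x) (hv : HasFDerivAt v v' x) :
    divOf (fderiv ℝ (fun x => f x • v x) x) = f x * divOf v' + f' (v x) := by
  rw [(hf.fun_smul hv).fderiv, ← divCLM_apply, map_add, map_smul, divCLM_apply, divCLM_apply,
    divOf_smulRight, smul_eq_mul]

lemma mul_setIntegral_ball_divOf_fderiv {F : E3 → E3} (hF : ContDiff ℝ 1 F) {R : ℝ} (hR : 0 < R) :
    R * ∫ x in ball 0 R, divOf (fderiv ℝ F x) = ∫ x, inner ℝ (F x) x ∂(surfaceMeasure R) := by
  have hcoord : ∀ i x v, fderiv ℝ (fun x => F x i) x v = fderiv ℝ F x v i := fun i x v => by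
    have hderiv : HasFDerivAt (fun x => F x i)
        ((EuclideanSpace.proj i : E3 →L[ℝ] ℝ).comp (fderiv ℝ F x)) x :=
      (EuclideanSpace.proj i : E3 →L[ℝ] ℝ).hasFDerivAt.comp x
        (hF.differentiable one_ne_zero x).hasFDerivAt
    rw [hderiv.fderiv]
    rfl
  have hdiv := smul_setIntegral_ball_sum_fderiv (volume : Measure E3)
    (EuclideanSpace.basisFun (Fin 3) ℝ) (f := fun i x => F x i)
    (fun i => (EuclideanSpace.proj i : E3 →L[ℝ] ℝ).contDiff.comp hF) hR
  simp only [hcoord, EuclideanSpace.basisFun_apply, EuclideanSpace.inner_single_right,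
    conj_trivial, smul_eq_mul, one_mul] at hdiv
  rw [integral_surfaceMeasure hR]
  simpa [divOf, e, PiLp.inner_apply, mul_comm] using hdiv

lemma setIntegral_ball_three_smul_add_fderiv {F : Type*} [NormedAddCommGroup F] [NormedSpace ℝ F]
    [CompleteSpace F] {f : E3 → F} (hf : ContDiff ℝ 1 f) {R : ℝ} (hR : 0 < R) :
    ∫ x in ball 0 R, ((3 : ℝ) • f x + fderiv ℝ f x x) = R • ∫ x, f x ∂(surfaceMeasure R) := by
  rw [integral_surfaceMeasure hR, ← setIntegral_ball_finrank_smul_add_fderiv volume hf hR,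
    finrank_euclideanSpace_fin, Nat.cast_ofNat]

end Divergence

section SmoothIdentities

/-- The scalar product of `x` with `(div w) w + curl w × w`, written in terms of `A = Dw`: the
divergence of the tensor `w ⊗ w - (|w|² / 2) I`, contracted with `x`. -/
def stressDiv (x : E3) (A : E3 →L[ℝ] E3) (w : E3) : ℝ :=
  divOf A * inner ℝ w x + inner ℝ x (A w) - inner ℝ w (A x)

lemma inner_cross_curlOf (x w : E3) (A : E3 →L[ℝ] E3) :
    inner ℝ x (cross (curlOf A) w) = inner ℝ x (A w) - inner ℝ w (A x) := by
  have hA : ∀ y, A y = y 0 • A (e 0) + y 1 • A (e 1) + y 2 • A (e 2) := fun y => by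
    conv_lhs => rw [← sum_smul_e y]
    simp [Fin.sum_univ_three]
  rw [hA w, hA x]
  simp [cross, curlOf, crossProduct, PiLp.inner_apply, Fin.sum_univ_three]
  ring

lemma stressDiv_eq_zero {x : E3} {A : E3 →L[ℝ] E3} {w : E3} (hdiv : divOf A = 0)
    (hcurl : cross (curlOf A) w = 0) : stressDiv x A w = 0 := by
  rw [stressDiv, hdiv, zero_mul, zero_add, ← inner_cross_curlOf, hcurl, inner_zero_right]

variable {m k : E3 → ℝ} {v : E3 → E3}

lemma hasFDerivAt_mul_norm_sq (hv : ContDiff ℝ 1 v)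
    (hm : ∀ x, HasFDerivAt m (k x • innerSL ℝ x) x) (x : E3) :
    HasFDerivAt (fun x => m x * ‖v x‖ ^ 2)
      (m x • 2 • (innerSL ℝ (v x)).comp (fderiv ℝ v x) + ‖v x‖ ^ 2 • k x • innerSL ℝ x) x :=
  (hm x).mul (hv.differentiable one_ne_zero x).hasFDerivAt.norm_sq

/-- The divergence theorem for the field `m |v|² x`. -/
lemma setIntegral_ball_mul_norm_sq (hv : ContDiff ℝ 1 v) (hmc : ContDiff ℝ 1 m)
    (hm : ∀ x, HasFDerivAt m (k x • innerSL ℝ x) x) {R : ℝ} (hR : 0 < R) :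
    ∫ x in ball 0 R, (2 * m x * inner ℝ (v x) (fderiv ℝ v x x)
        + (3 * m x + k x * ‖x‖ ^ 2) * ‖v x‖ ^ 2)
      = ∫ x, R * m x * ‖v x‖ ^ 2 ∂(surfaceMeasure R) := by
  have hrad := setIntegral_ball_three_smul_add_fderiv (hmc.mul (hv.norm_sq ℝ)) hR
  rw [← integral_smul] at hrad
  simp only [smul_eq_mul, ← mul_assoc] at hrad
  rw [← hrad]
  congr 1 with x
  rw [(hasFDerivAt_mul_norm_sq hv hm x).fderiv]
  simp
  ring

lemma divOf_fderiv_stress (hv : ContDiff ℝ 1 v)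
    (hm : ∀ x, HasFDerivAt m (k x • innerSL ℝ x) x) (x : E3) :
    divOf (fderiv ℝ (fun x => (m x * inner ℝ (v x) x) • v x
        - (1 / 2 * (m x * ‖v x‖ ^ 2)) • x) x)
      = m x * stressDiv x (fderiv ℝ v x) (v x)
        + (k x * inner ℝ (v x) x ^ 2 - (k x * ‖x‖ ^ 2 + m x) / 2 * ‖v x‖ ^ 2) := by
  have hvd := (hv.differentiable one_ne_zero x).hasFDerivAt
  have hid : HasFDerivAt (fun x : E3 => x) (ContinuousLinearMap.id ℝ E3) x := hasFDerivAt_id x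
  have hprod := (hm x).fun_mul (hvd.inner ℝ hid)
  have hhalf := (hasFDerivAt_mul_norm_sq hv hm x).const_mul (1 / 2 : ℝ)
  rw [fderiv_fun_sub (hprod.fun_smul hvd).differentiableAt (hhalf.fun_smul hid).differentiableAt,
    ← divCLM_apply, map_sub, divCLM_apply, divCLM_apply, divOf_fderiv_smul hprod hvd,
    divOf_fderiv_smul hhalf hid, divOf_id]
  simp [stressDiv, real_inner_comm x (v x), real_inner_comm x (fderiv ℝ v x (v x))]
  ring

/-- The divergence theorem for the field `m (v · x) v - (m |v|² / 2) x`. -/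
lemma setIntegral_ball_stressDiv (hv : ContDiff ℝ 1 v) (hmc : ContDiff ℝ 1 m)
    (hm : ∀ x, HasFDerivAt m (k x • innerSL ℝ x) x) {R : ℝ} (hR : 0 < R) :
    ∫ x in ball 0 R, (R * m x * stressDiv x (fderiv ℝ v x) (v x)
        + (R * k x * inner ℝ (v x) x ^ 2 - R * (k x * ‖x‖ ^ 2 + m x) / 2 * ‖v x‖ ^ 2))
      = ∫ x, (m x * inner ℝ (v x) x ^ 2 - m x * ‖x‖ ^ 2 / 2 * ‖v x‖ ^ 2)
          ∂(surfaceMeasure R) := by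
  have hvx : ContDiff ℝ 1 fun x => (m x * inner ℝ (v x) x) • v x :=
    (hmc.mul (hv.inner ℝ contDiff_id)).smul hv
  have hxx : ContDiff ℝ 1 fun x => (1 / 2 * (m x * ‖v x‖ ^ 2)) • x :=
    (contDiff_const.mul (hmc.mul (hv.norm_sq ℝ))).smul contDiff_id
  have hgauss := mul_setIntegral_ball_divOf_fderiv (hvx.sub hxx) hR
  simp only [divOf_fderiv_stress hv hm] at hgauss
  rw [← integral_const_mul] at hgauss
  convert hgauss using 1
  · congr 1 with x
    ring
  · congr 1 with x
    simp only [inner_sub_left, real_inner_smul_left, real_inner_self_eq_norm_sq]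
    ring

end SmoothIdentities

section Mollify

variable {E F : Type*} [NormedAddCommGroup E] [NormedSpace ℝ E] [FiniteDimensional ℝ E]
  [MeasurableSpace E] [BorelSpace E] [NormedAddCommGroup F] [NormedSpace ℝ F]
  {μ : Measure E} [μ.IsAddHaarMeasure]

variable (μ) in
/-- The probability measure whose density with respect to `μ` is a normalized smooth bump. -/
def bumpMeasure (φ : ContDiffBump (0 : E)) : Measure E :=
  μ.withDensity fun t => ENNReal.ofReal (φ.normed μ t)

variable (μ) in
/-- The mollification of `f`: its convolution with a normalized smooth bump. -/
def mollify (φ : ContDiffBump (0 : E)) (f : E → F) : E → F :=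
  convolution (φ.normed μ) f (ContinuousLinearMap.lsmul ℝ ℝ) μ

lemma isProbabilityMeasure_bumpMeasure (φ : ContDiffBump (0 : E)) :
    IsProbabilityMeasure (bumpMeasure μ φ) where
  measure_univ := by
    rw [bumpMeasure, withDensity_apply _ MeasurableSet.univ, Measure.restrict_univ,
      ← ofReal_integral_eq_lintegral_ofReal φ.integrable_normed (.of_forall φ.nonneg_normed),
      φ.integral_normed, ENNReal.ofReal_one]

lemma ae_bumpMeasure_norm_lt (φ : ContDiffBump (0 : E)) :
    ∀ᵐ t ∂(bumpMeasure μ φ), ‖t‖ < φ.rOut := by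
  rw [bumpMeasure, ae_withDensity_iff φ.continuous_normed.measurable.ennreal_ofReal]
  refine .of_forall fun t ht => ?_
  have htmem : t ∈ Function.support (φ.normed μ) := fun h => ht (by rw [h, ENNReal.ofReal_zero])
  rwa [φ.support_normed_eq, mem_ball_zero_iff] at htmem

lemma convolutionExists_mollify (φ : ContDiffBump (0 : E)) {f : E → F}
    (hf : LocallyIntegrable f μ) :
    ConvolutionExists (φ.normed μ) f (ContinuousLinearMap.lsmul ℝ ℝ) μ :=
  φ.hasCompactSupport_normed.convolutionExists_left _ φ.continuous_normed hf

lemma contDiff_mollify (φ : ContDiffBump (0 : E)) {f : E → F} (hf : LocallyIntegrable f μ) :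
    ContDiff ℝ ∞ (mollify μ φ f) :=
  φ.hasCompactSupport_normed.contDiff_convolution_left _ φ.contDiff_normed hf

lemma hasCompactSupport_mollify (φ : ContDiffBump (0 : E)) {f : E → F}
    (hf : HasCompactSupport f) : HasCompactSupport (mollify μ φ f) :=
  φ.hasCompactSupport_normed.convolution _ hf

lemma mollify_sub_eq_integral [CompleteSpace F] (φ : ContDiffBump (0 : E)) {f : E → F}
    (hf : LocallyIntegrable f μ) (x : E) :
    mollify μ φ f x - f x = ∫ t, φ.normed μ t • (f (x - t) - f x) ∂μ := by
  simp_rw [smul_sub]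
  refine Eq.trans ?_ (integral_sub (convolutionExists_mollify φ hf x)
    (φ.integrable_normed.smul_const _)).symm
  rw [φ.integral_normed_smul]
  rfl

lemma enorm_mollify_sub_le [CompleteSpace F] (φ : ContDiffBump (0 : E)) {f : E → F}
    (hf : LocallyIntegrable f μ) (x : E) :
    ‖mollify μ φ f x - f x‖ₑ ≤ ∫⁻ t, ‖f (x - t) - f x‖ₑ ∂(bumpMeasure μ φ) := by
  have hfx : AEStronglyMeasurable (fun t => f (x - t) - f x) μ :=
    (hf.aestronglyMeasurable.comp_measurePreserving
      (Measure.measurePreserving_sub_left μ x)).sub aestronglyMeasurable_const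
  rw [bumpMeasure, lintegral_withDensity_eq_lintegral_mul₀
    φ.continuous_normed.measurable.ennreal_ofReal.aemeasurable hfx.enorm,
    mollify_sub_eq_integral φ hf]
  refine (enorm_integral_le_lintegral_enorm _).trans_eq (lintegral_congr fun t => ?_)
  rw [enorm_smul, Pi.mul_apply, Real.enorm_of_nonneg (φ.nonneg_normed t)]

omit [NormedSpace ℝ F] in
lemma lintegral_enorm_rpow_le {α : Type*} [MeasurableSpace α] {ν : Measure α}
    [IsProbabilityMeasure ν] {f : α → F} (hf : AEStronglyMeasurable f ν) {p : ℝ} (hp : 1 ≤ p) :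
    (∫⁻ t, ‖f t‖ₑ ∂ν) ^ p ≤ ∫⁻ t, ‖f t‖ₑ ^ p ∂ν := by
  have h := eLpNorm'_le_eLpNorm'_of_exponent_le zero_lt_one hp ν hf
  simp only [eLpNorm', ENNReal.rpow_one, div_one] at h
  calc (∫⁻ t, ‖f t‖ₑ ∂ν) ^ p
      ≤ ((∫⁻ t, ‖f t‖ₑ ^ p ∂ν) ^ (1 / p)) ^ p := ENNReal.rpow_le_rpow h (by linarith)
    _ = ∫⁻ t, ‖f t‖ₑ ^ p ∂ν := by
      rw [← ENNReal.rpow_mul, one_div, inv_mul_cancel₀ (by linarith), ENNReal.rpow_one]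

omit [NormedSpace ℝ F] in
lemma eLpNorm_le_iff_lintegral_rpow_enorm_le {α : Type*} [MeasurableSpace α] {ν : Measure α}
    {f : α → F} {p c : ℝ≥0∞} (hp : p ≠ 0) (hp' : p ≠ ⊤) :
    eLpNorm f p ν ≤ c ↔ ∫⁻ x, ‖f x‖ₑ ^ p.toReal ∂ν ≤ c ^ p.toReal := by
  rw [eLpNorm_eq_lintegral_rpow_enorm_toReal hp hp', one_div,
    ENNReal.rpow_inv_le_iff (ENNReal.toReal_pos hp hp')]

/-- Minkowski's inequality would give this for all `p`; for `p < ∞` it is Jensen and Tonelli. -/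
lemma eLpNorm_mollify_sub_le [CompleteSpace F] (φ : ContDiffBump (0 : E)) {f : E → F}
    (hf : LocallyIntegrable f μ) {p c : ℝ≥0∞} (hp : 1 ≤ p) (hp' : p ≠ ⊤)
    (hc : ∀ t, ‖t‖ < φ.rOut → eLpNorm (fun x => f (x - t) - f x) p μ ≤ c) :
    eLpNorm (mollify μ φ f - f) p μ ≤ c := by
  have := isProbabilityMeasure_bumpMeasure (μ := μ) φ
  have hp0 : p ≠ 0 := (zero_lt_one.trans_le hp).ne'
  have hq : 1 ≤ p.toReal := ENNReal.toReal_one ▸ ENNReal.toReal_mono hp' hp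
  have hfm := hf.aestronglyMeasurable
  have hdiff : AEStronglyMeasurable (fun z : E × E => f (z.1 - z.2) - f z.1)
      (μ.prod (bumpMeasure μ φ)) :=
    (hfm.comp_quasiMeasurePreserving
      (quasiMeasurePreserving_sub_of_right_invariant μ _)).sub hfm.comp_fst
  have hae : ∀ᵐ x ∂μ, ‖mollify μ φ f x - f x‖ₑ ^ p.toReal
      ≤ ∫⁻ t, ‖f (x - t) - f x‖ₑ ^ p.toReal ∂(bumpMeasure μ φ) := by
    filter_upwards [hdiff.prodMk_left] with x hx
    exact (ENNReal.rpow_le_rpow (enorm_mollify_sub_le φ hf x) (by linarith)).trans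
      (lintegral_enorm_rpow_le hx hq)
  rw [eLpNorm_le_iff_lintegral_rpow_enorm_le hp0 hp']
  calc ∫⁻ x, ‖(mollify μ φ f - f) x‖ₑ ^ p.toReal ∂μ
      ≤ ∫⁻ x, ∫⁻ t, ‖f (x - t) - f x‖ₑ ^ p.toReal ∂(bumpMeasure μ φ) ∂μ := lintegral_mono_ae hae
    _ = ∫⁻ t, ∫⁻ x, ‖f (x - t) - f x‖ₑ ^ p.toReal ∂μ ∂(bumpMeasure μ φ) :=
      lintegral_lintegral_swap (hdiff.enorm.pow_const _)
    _ ≤ ∫⁻ _, c ^ p.toReal ∂(bumpMeasure μ φ) := by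
      refine lintegral_mono_ae ?_
      filter_upwards [ae_bumpMeasure_norm_lt φ] with t ht
      exact (eLpNorm_le_iff_lintegral_rpow_enorm_le hp0 hp').1 (hc t ht)
    _ = c ^ p.toReal := by simp

/-- Bump functions shrinking to the origin. -/
def shrinkingBump (n : ℕ) : ContDiffBump (0 : E) where
  rIn := 1 / (2 * ((n : ℝ) + 1))
  rOut := 1 / ((n : ℝ) + 1)
  rIn_pos := by positivity
  rIn_lt_rOut := one_div_lt_one_div_of_lt (by positivity) (by linarith [n.cast_nonneg (α := ℝ)])

omit [NormedSpace ℝ E] [FiniteDimensional ℝ E] [MeasurableSpace E] [BorelSpace E] in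
lemma tendsto_shrinkingBump_rOut :
    Tendsto (fun n => (shrinkingBump (E := E) n).rOut) atTop (𝓝 0) :=
  tendsto_one_div_add_atTop_nhds_zero_nat

omit [NormedSpace ℝ F] in
lemma tendsto_eLpNorm_comp_sub_sub {f : E → F} {p : ℝ≥0∞} (hp : 1 ≤ p) (hp' : p ≠ ⊤)
    (hf : MemLp f p μ) :
    Tendsto (fun t => eLpNorm (fun x => f (x - t) - f x) p μ) (𝓝 0) (𝓝 0) := by
  have : Fact (1 ≤ p) := ⟨hp⟩
  have : Fact (p ≠ ⊤) := ⟨hp'⟩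
  have hcont : Continuous fun t : E => DomAddAct.mk (-t) +ᵥ hf.toLp f :=
    (DomAddAct.continuous_mk.comp continuous_neg).vadd continuous_const
  have hlim : Tendsto (fun t : E => DomAddAct.mk (-t) +ᵥ hf.toLp f) (𝓝 0) (𝓝 (hf.toLp f)) := by
    simpa using hcont.tendsto 0
  refine (tendsto_iff_edist_tendsto_0.1 hlim).congr fun t => ?_
  rw [DomAddAct.mk_vadd_toLp, Lp.edist_toLp_toLp]
  simp only [vadd_eq_add, neg_add_eq_sub, Pi.sub_def]

theorem tendsto_eLpNorm_mollify_sub [CompleteSpace F] {f : E → F} {p : ℝ≥0∞} (hp : 1 ≤ p)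
    (hp' : p ≠ ⊤) (hf : MemLp f p μ) :
    Tendsto (fun n => eLpNorm (mollify μ (shrinkingBump n) f - f) p μ) atTop (𝓝 0) := by
  refine ENNReal.tendsto_nhds_zero.2 fun ε hε => ?_
  obtain ⟨δ, hδ, hδε⟩ := Metric.eventually_nhds_iff.1
    (ENNReal.tendsto_nhds_zero.1 (tendsto_eLpNorm_comp_sub_sub hp hp' hf) ε hε)
  filter_upwards [(tendsto_shrinkingBump_rOut (E := E)).eventually (gt_mem_nhds hδ)] with n hn
  exact eLpNorm_mollify_sub_le (shrinkingBump n) (hf.locallyIntegrable hp) hp hp' fun t ht =>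
    hδε (by rw [dist_zero_right]; exact ht.trans hn)

end Mollify

section OperatorFields

variable {X F F' : Type*} [NormedAddCommGroup F] [NormedSpace ℝ F] [NormedAddCommGroup F']
  [NormedSpace ℝ F']

lemma memLp_clm_apply [MeasurableSpace X] {μ : Measure X} {B : X → F →L[ℝ] F'} {f : X → F}
    {p : ℝ≥0∞} {C : ℝ} (hB : AEStronglyMeasurable B μ) (hC : ∀ᵐ x ∂μ, ‖B x‖ ≤ C)
    (hf : MemLp f p μ) : MemLp (fun x => B x (f x)) p μ :=
  hf.of_le_mul ((ContinuousLinearMap.id ℝ (F →L[ℝ] F')).aestronglyMeasurable_comp₂ hB hf.1)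
    (hC.mono fun _ hx => (B _).le_of_opNorm_le hx _)

variable [TopologicalSpace X] [T2Space X] [MeasurableSpace X] [BorelSpace X] {μ : Measure X}
  [SecondCountableTopologyEither X (F →L[ℝ] F')]

lemma memLp_restrict_clm_apply {B : X → F →L[ℝ] F'} {f : X → F} {p : ℝ≥0∞} {K : Set X}
    (hB : Continuous B) (hK : IsCompact K) (hf : MemLp f p (μ.restrict K)) :
    MemLp (fun x => B x (f x)) p (μ.restrict K) := by
  obtain ⟨C, hC⟩ := hK.exists_bound_of_continuousOn hB.continuousOn
  exact memLp_clm_apply hB.aestronglyMeasurable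
    (ae_restrict_of_forall_mem hK.measurableSet hC) hf

lemma locallyIntegrable_clm_apply [LocallyCompactSpace X] {B : X → F →L[ℝ] F'} {f : X → F}
    (hB : Continuous B) (hf : LocallyIntegrable f μ) :
    LocallyIntegrable (fun x => B x (f x)) μ :=
  locallyIntegrable_iff.2 fun _ hK => memLp_one_iff_integrable.1 <|
    memLp_restrict_clm_apply hB hK (memLp_one_iff_integrable.2 (hf.integrableOn_isCompact hK))

end OperatorFields

section WeakDerivative

lemma MemLpLoc.memLp_clm_apply {F F' : Type*} [NormedAddCommGroup F] [NormedSpace ℝ F]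
    [NormedAddCommGroup F'] [NormedSpace ℝ F'] {f : E3 → F} {p : ℝ≥0∞} (hf : MemLpLoc f p)
    {B : E3 → F →L[ℝ] F'} (hB : Continuous B) (hBc : HasCompactSupport B) :
    MemLp (fun x => B x (f x)) p volume := by
  rw [← Set.indicator_eq_self.2 (show Function.support (fun x => B x (f x)) ⊆ tsupport B from
    fun x hx => by_contra fun h => hx (by simp [image_eq_zero_of_notMem_tsupport h]))]
  exact (memLp_indicator_iff_restrict hBc.measurableSet).2
    (memLp_restrict_clm_apply hB hBc (hf _ hBc))

lemma MemLpLoc.memLp_smul {F : Type*} [NormedAddCommGroup F] [NormedSpace ℝ F] {f : E3 → F}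
    {p : ℝ≥0∞} (hf : MemLpLoc f p) {χ : E3 → ℝ} (hχ : Continuous χ) (hχc : HasCompactSupport χ) :
    MemLp (fun x => χ x • f x) p volume :=
  hf.memLp_clm_apply (B := fun x => χ x • ContinuousLinearMap.id ℝ F)
    (hχ.smul continuous_const) hχc.smul_right

variable {u : E3 → E3} {G : E3 → E3 →L[ℝ] E3}

lemma HasWeakDeriv.ae_eq {G' : E3 → E3 →L[ℝ] E3} (h : HasWeakDeriv u G)
    (h' : HasWeakDeriv u G') : G =ᵐ[volume] G' := by
  refine ae_eq_of_integral_contDiff_smul_eq h.locallyIntegrable_deriv h'.locallyIntegrable_deriv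
    fun φ hφ hφc => ContinuousLinearMap.ext fun v => ?_
  rw [ContinuousLinearMap.integral_apply, ContinuousLinearMap.integral_apply]
  · exact neg_injective ((h.integral_eq φ hφ hφc v).symm.trans (h'.integral_eq φ hφ hφc v))
  · exact h'.locallyIntegrable_deriv.integrable_smul_left_of_hasCompactSupport hφ.continuous hφc
  · exact h.locallyIntegrable_deriv.integrable_smul_left_of_hasCompactSupport hφ.continuous hφc

lemma HasWeakDeriv.smul (h : HasWeakDeriv u G) {χ : E3 → ℝ} (hχ : ContDiff ℝ ∞ χ) :
    HasWeakDeriv (fun x => χ x • u x)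
      (fun x => χ x • G x + (fderiv ℝ χ x).smulRight (u x)) where
  locallyIntegrable := h.locallyIntegrable.continuous_smul hχ.continuous
  locallyIntegrable_deriv := (h.locallyIntegrable_deriv.continuous_smul hχ.continuous).add
    (locallyIntegrable_clm_apply (B := fun x => ContinuousLinearMap.smulRightL ℝ E3 E3
      (fderiv ℝ χ x)) ((ContinuousLinearMap.continuous _).comp (hχ.continuous_fderiv (by simp)))
      h.locallyIntegrable)
  integral_eq φ hφ hφc v := by
    have hφd : Continuous fun x => fderiv ℝ φ x v :=
      (hφ.continuous_fderiv (by simp)).clm_apply continuous_const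
    have hχd : Continuous fun x => fderiv ℝ χ x v :=
      (hχ.continuous_fderiv (by simp)).clm_apply continuous_const
    have hderiv (x : E3) : fderiv ℝ (fun x => φ x * χ x) x v
        = φ x * fderiv ℝ χ x v + χ x * fderiv ℝ φ x v := by
      rw [fderiv_fun_mul (hφ.differentiable (by simp) x) (hχ.differentiable (by simp) x)]
      simp
    have hint₁ : Integrable fun x => (φ x * fderiv ℝ χ x v) • u x :=
      h.locallyIntegrable.integrable_smul_left_of_hasCompactSupport
        (hφ.continuous.mul hχd) hφc.mul_right
    have hint₂ : Integrable fun x => (χ x * fderiv ℝ φ x v) • u x :=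
      h.locallyIntegrable.integrable_smul_left_of_hasCompactSupport
        (hχ.continuous.mul hφd) ((hφc.fderiv_apply (𝕜 := ℝ) v).mul_left)
    have hint₃ : Integrable fun x => (φ x * χ x) • G x v :=
      (h.locallyIntegrable_deriv.integrable_smul_left_of_hasCompactSupport
        (hφ.continuous.mul hχ.continuous) hφc.mul_right).apply_continuousLinearMap v
    have hweak := h.integral_eq (fun x => φ x * χ x) (hφ.mul hχ) hφc.mul_right v
    simp_rw [hderiv, add_smul] at hweak
    rw [integral_add hint₁ hint₂] at hweak
    calc ∫ x, fderiv ℝ φ x v • χ x • u x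
        = ∫ x, (χ x * fderiv ℝ φ x v) • u x := by simp only [smul_smul, mul_comm]
      _ = -((∫ x, (φ x * χ x) • G x v) + ∫ x, (φ x * fderiv ℝ χ x v) • u x) := by
        rw [neg_add, ← hweak]; abel
      _ = -∫ x, φ x • (χ x • G x + (fderiv ℝ χ x).smulRight (u x)) v := by
        rw [← integral_add hint₃ hint₁]
        simp [smul_smul]

lemma fderiv_mollify (h : HasWeakDeriv u G) (φ : ContDiffBump (0 : E3)) :
    fderiv ℝ (mollify volume φ u) = mollify volume φ G := by
  set ψ : E3 → ℝ := φ.normed volume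
  have hψ : ContDiff ℝ ∞ ψ := φ.contDiff_normed
  have hψ1 : ContDiff ℝ 1 ψ := φ.contDiff_normed
  have hψc : HasCompactSupport ψ := φ.hasCompactSupport_normed
  ext1 x
  ext1 v
  have hderiv (t : E3) : fderiv ℝ (fun t => ψ (x - t)) t v = -fderiv ℝ ψ (x - t) v := by
    have hcomp := (hψ1.differentiable one_ne_zero (x - t)).hasFDerivAt.comp t
      ((hasFDerivAt_id (𝕜 := ℝ) t).const_sub x)
    simpa using DFunLike.congr_fun (HasFDerivAt.fderiv (f := fun t => ψ (x - t)) hcomp) v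
  have hweak := h.integral_eq (fun t => ψ (x - t)) (hψ.comp (contDiff_const.sub contDiff_id))
    (hψc.comp_homeomorph (Homeomorph.subLeft x)) v
  simp_rw [hderiv, neg_smul, integral_neg, neg_inj] at hweak
  have hex : ConvolutionExistsAt (fderiv ℝ ψ) u x
      (ContinuousLinearMap.precompL E3 (ContinuousLinearMap.lsmul ℝ ℝ)) volume :=
    (hψc.fderiv (𝕜 := ℝ)).convolutionExists_left _ (hψ1.continuous_fderiv one_ne_zero)
      h.locallyIntegrable x
  rw [mollify, mollify, (hψc.hasFDerivAt_convolution_left (ContinuousLinearMap.lsmul ℝ ℝ) hψ1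
    h.locallyIntegrable x).fderiv, convolution_eq_swap, convolution_eq_swap,
    ContinuousLinearMap.integral_apply hex.integrable_swap, ContinuousLinearMap.integral_apply
      (convolutionExists_mollify φ h.locallyIntegrable_deriv x).integrable_swap]
  exact hweak

end WeakDerivative

section Sobolev

lemma memLp_of_tendsto_eLpNorm_of_eventually_le {X F : Type*} [MeasurableSpace X] {μ : Measure X}
    [NormedAddCommGroup F] {f : ℕ → X → F} {g : X → F} {p q c : ℝ≥0∞} (hp : p ≠ 0)
    (hf : ∀ n, AEStronglyMeasurable (f n) μ) (hg : AEStronglyMeasurable g μ)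
    (hfg : Tendsto (fun n => eLpNorm (f n - g) p μ) atTop (𝓝 0)) (hc : c ≠ ⊤)
    (hle : ∀ᶠ n in atTop, eLpNorm (f n) q μ ≤ c) : MemLp g q μ := by
  obtain ⟨ns, hns, hlim⟩ := (tendstoInMeasure_of_tendsto_eLpNorm hp hf hg hfg).exists_seq_tendsto_ae
  refine ⟨hg, ((Lp.eLpNorm_lim_le_liminf_eLpNorm (fun n => hf (ns n)) g hlim).trans
    (liminf_le_of_frequently_le' ?_)).trans_lt hc.lt_top⟩
  exact (hns.tendsto_atTop.eventually hle).frequently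

lemma eventually_eLpNorm_le_one_add {X F : Type*} [MeasurableSpace X] {μ : Measure X}
    [NormedAddCommGroup F] {f : ℕ → X → F} {g : X → F} {p : ℝ≥0∞} (hp : 1 ≤ p)
    (hf : ∀ n, AEStronglyMeasurable (f n) μ) (hg : AEStronglyMeasurable g μ)
    (hfg : Tendsto (fun n => eLpNorm (f n - g) p μ) atTop (𝓝 0)) :
    ∀ᶠ n in atTop, eLpNorm (f n) p μ ≤ 1 + eLpNorm g p μ := by
  filter_upwards [hfg.eventually_le_const zero_lt_one] with n hn
  calc eLpNorm (f n) p μ = eLpNorm (f n - g + g) p μ := by rw [sub_add_cancel]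
    _ ≤ eLpNorm (f n - g) p μ + eLpNorm g p μ := eLpNorm_add_le ((hf n).sub hg) hg hp
    _ ≤ 1 + eLpNorm g p μ := by gcongr

variable {u : E3 → E3} {G : E3 → E3 →L[ℝ] E3}

lemma HasWeakDeriv.memLp_of_hasCompactSupport (h : HasWeakDeriv u G) (huc : HasCompactSupport u)
    {p q : NNReal} (hp : 1 ≤ p) (hq : (q : ℝ)⁻¹ = (p : ℝ)⁻¹ - 3⁻¹) (hu : MemLp u p volume)
    (hG : MemLp G p volume) : MemLp u q volume := by
  have hp1 : (1 : ℝ≥0∞) ≤ p := by exact_mod_cast hp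
  have hsmooth (n : ℕ) : ContDiff ℝ ∞ (mollify volume (shrinkingBump n) u) :=
    contDiff_mollify _ h.locallyIntegrable
  have hsobolev (n : ℕ) : eLpNorm (mollify volume (shrinkingBump n) u) q volume
      ≤ SNormLESNormFDerivOfEqConst E3 (volume : Measure E3) p
        * eLpNorm (mollify volume (shrinkingBump n) G) p volume := by
    rw [← fderiv_mollify h]
    exact eLpNorm_le_eLpNorm_fderiv_of_eq volume ((hsmooth n).of_le (by simp))
      (hasCompactSupport_mollify _ huc) hp (by simp) (by simpa using hq)
  have hbound := eventually_eLpNorm_le_one_add hp1 (fun n => (contDiff_mollify (shrinkingBump n)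
    h.locallyIntegrable_deriv).continuous.aestronglyMeasurable) hG.1
    (tendsto_eLpNorm_mollify_sub hp1 ENNReal.coe_ne_top hG)
  exact memLp_of_tendsto_eLpNorm_of_eventually_le (zero_lt_one.trans_le hp1).ne'
    (fun n => (hsmooth n).continuous.aestronglyMeasurable) hu.1
    (tendsto_eLpNorm_mollify_sub hp1 ENNReal.coe_ne_top hu)
    (ENNReal.mul_ne_top ENNReal.coe_ne_top (ENNReal.add_ne_top.2 ⟨ENNReal.one_ne_top, hG.2.ne⟩))
    (hbound.mono fun n hn => (hsobolev n).trans (mul_le_mul_right hn _))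

/-- Multiply by a smooth cutoff which is `1` near the ball. -/
lemma HasWeakDeriv.exists_hasCompactSupport_eqOn_ball (h : HasWeakDeriv u G) {p : ℝ≥0∞}
    (hu : MemLpLoc u p) (hG : MemLpLoc G p) (R : ℝ) :
    ∃ U A, HasWeakDeriv U A ∧ HasCompactSupport U ∧ MemLp U p volume ∧ MemLp A p volume ∧
      Set.EqOn U u (ball 0 R) ∧ Set.EqOn A G (ball 0 R) := by
  let χ : ContDiffBump (0 : E3) := ⟨|R| + 1, |R| + 2, by positivity, by linarith⟩
  have hχ : ContDiff ℝ ∞ χ := χ.contDiff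
  have hχ_one {x : E3} (hx : x ∈ ball 0 R) : χ =ᶠ[𝓝 x] fun _ => 1 := by
    have hR : R ≤ |R| + 1 := (le_abs_self R).trans (by linarith)
    filter_upwards [isOpen_ball.mem_nhds (ball_subset_ball hR hx)] with y hy
    exact χ.one_of_mem_closedBall (ball_subset_closedBall hy)
  refine ⟨_, _, h.smul hχ, χ.hasCompactSupport.smul_right,
    hu.memLp_smul hχ.continuous χ.hasCompactSupport,
    (hG.memLp_smul hχ.continuous χ.hasCompactSupport).add
      (hu.memLp_clm_apply (B := fun x => ContinuousLinearMap.smulRightL ℝ E3 E3 (fderiv ℝ χ x))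
        ((ContinuousLinearMap.continuous _).comp (hχ.continuous_fderiv (by simp)))
        ((χ.hasCompactSupport.fderiv (𝕜 := ℝ)).comp_left (map_zero _))),
    fun x hx => ?_, fun x hx => ?_⟩
  · simp [(hχ_one hx).eq_of_nhds]
  · ext
    simp [(hχ_one hx).eq_of_nhds, (hχ_one hx).fderiv_eq]

lemma tendsto_eLpNorm_restrict_of_eqOn {X F : Type*} [MeasurableSpace X] {μ : Measure X}
    [NormedAddCommGroup F] {f : ℕ → X → F} {g g' : X → F} {p : ℝ≥0∞} {s : Set X}
    (hs : MeasurableSet s) (hg : Set.EqOn g g' s)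
    (hfg : Tendsto (fun n => eLpNorm (f n - g) p μ) atTop (𝓝 0)) :
    Tendsto (fun n => eLpNorm (f n - g') p (μ.restrict s)) atTop (𝓝 0) := by
  refine tendsto_of_tendsto_of_tendsto_of_le_of_le tendsto_const_nhds hfg (fun _ => zero_le)
    fun n => (eLpNorm_congr_ae ?_).trans_le (eLpNorm_restrict_le _ _ _ s)
  filter_upwards [ae_restrict_mem hs] with x hx
  rw [Pi.sub_apply, Pi.sub_apply, hg hx]

theorem HasWeakDeriv.exists_contDiff_tendsto (h : HasWeakDeriv u G) {p q : NNReal} (hp : 1 ≤ p)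
    (hq1 : 1 ≤ q) (hq : (q : ℝ)⁻¹ = (p : ℝ)⁻¹ - 3⁻¹) (hu : MemLpLoc u p) (hG : MemLpLoc G p)
    (R : ℝ) :
    MemLp u q (volume.restrict (ball 0 R)) ∧ ∃ v : ℕ → E3 → E3, (∀ n, ContDiff ℝ ∞ (v n)) ∧
      Tendsto (fun n => eLpNorm (v n - u) q (volume.restrict (ball 0 R))) atTop (𝓝 0) ∧
      Tendsto (fun n => eLpNorm (fderiv ℝ (v n) - G) p (volume.restrict (ball 0 R)))
        atTop (𝓝 0) := by
  have hp1 : (1 : ℝ≥0∞) ≤ p := by exact_mod_cast hp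
  have hq1 : (1 : ℝ≥0∞) ≤ q := by exact_mod_cast hq1
  obtain ⟨U, A, hUA, hUc, hUp, hAp, hUu, hAG⟩ := h.exists_hasCompactSupport_eqOn_ball hu hG R
  have hUq : MemLp U q volume := hUA.memLp_of_hasCompactSupport hUc hp hq hUp hAp
  refine ⟨(hUq.restrict _).ae_eq (ae_restrict_of_forall_mem measurableSet_ball hUu),
    fun n => mollify volume (shrinkingBump n) U,
    fun n => contDiff_mollify _ hUA.locallyIntegrable,
    tendsto_eLpNorm_restrict_of_eqOn measurableSet_ball hUu
      (tendsto_eLpNorm_mollify_sub hq1 ENNReal.coe_ne_top hUq), ?_⟩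
  simp only [fderiv_mollify hUA]
  exact tendsto_eLpNorm_restrict_of_eqOn measurableSet_ball hAG
    (tendsto_eLpNorm_mollify_sub hp1 ENNReal.coe_ne_top hAp)

end Sobolev

section Convergence

variable {X F F₁ F₂ : Type*} [MeasurableSpace X] {μ : Measure X} [NormedAddCommGroup F]
  [NormedSpace ℝ F] [NormedAddCommGroup F₁] [NormedSpace ℝ F₁] [NormedAddCommGroup F₂]
  [NormedSpace ℝ F₂] {ι : Type*} {l : Filter ι} {p q : ℝ≥0∞}

omit [NormedSpace ℝ F] in
lemma tendsto_eLpNorm_of_exponent_le [IsFiniteMeasure μ] {f : ι → X → F} (hp : p ≠ 0)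
    (hpq : p ≤ q) (hf : ∀ i, AEStronglyMeasurable (f i) μ)
    (h : Tendsto (fun i => eLpNorm (f i) q μ) l (𝓝 0)) :
    Tendsto (fun i => eLpNorm (f i) p μ) l (𝓝 0) := by
  have hexp : 0 ≤ 1 / p.toReal - 1 / q.toReal := by
    rcases eq_or_ne q ⊤ with rfl | hq
    · simp
    · exact sub_nonneg.2 (one_div_le_one_div_of_le
        (ENNReal.toReal_pos hp (ne_top_of_le_ne_top hq hpq)) (ENNReal.toReal_mono hq hpq))
  refine tendsto_of_tendsto_of_tendsto_of_le_of_le tendsto_const_nhds ?_ (fun _ => zero_le)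
    fun i => eLpNorm_le_eLpNorm_mul_rpow_measure_univ hpq (hf i)
  simpa only [zero_mul] using ENNReal.Tendsto.mul_const h
    (Or.inr (ENNReal.rpow_ne_top_of_nonneg hexp (measure_ne_top _ _)))

omit [NormedSpace ℝ F] in
lemma tendsto_eLpNorm_sub_sub {f : ℕ → X → F} {g : X → F} (hp : 1 ≤ p)
    (hf : ∀ n, AEStronglyMeasurable (f n) μ) (hg : AEStronglyMeasurable g μ)
    (h : Tendsto (fun n => eLpNorm (f n - g) p μ) atTop (𝓝 0)) :
    Tendsto (fun n : ℕ × ℕ => eLpNorm (f n.1 - f n.2) p μ) atTop (𝓝 0) := by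
  have hsum := (h.comp tendsto_fst).add (h.comp tendsto_snd)
  rw [prod_atTop_atTop_eq, add_zero] at hsum
  refine tendsto_of_tendsto_of_tendsto_of_le_of_le tendsto_const_nhds hsum (fun _ => zero_le)
    fun n => ?_
  rw [← sub_sub_sub_cancel_right _ _ g]
  exact eLpNorm_sub_le ((hf _).sub hg) ((hf _).sub hg) hp

omit [NormedSpace ℝ F] in
lemma exists_memLp_tendsto [CompleteSpace F] {f : ℕ → X → F} [Fact (1 ≤ p)]
    (hf : ∀ n, MemLp (f n) p μ)
    (h : Tendsto (fun n : ℕ × ℕ => eLpNorm (f n.1 - f n.2) p μ) atTop (𝓝 0)) :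
    ∃ g, MemLp g p μ ∧ Tendsto (fun n => eLpNorm (f n - g) p μ) atTop (𝓝 0) := by
  have hcauchy : CauchySeq fun n => (hf n).toLp (f n) := by
    rw [Lp.cauchySeq_Lp_iff_cauchySeq_eLpNorm]
    exact h.congr fun n =>
      eLpNorm_congr_ae ((hf n.1).coeFn_toLp.symm.sub (hf n.2).coeFn_toLp.symm)
  obtain ⟨g, hg⟩ := cauchySeq_tendsto_of_complete hcauchy
  exact ⟨g, Lp.memLp g, ((Lp.tendsto_Lp_iff_tendsto_eLpNorm' _ _).1 hg).congr fun n =>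
    eLpNorm_congr_ae ((hf n).coeFn_toLp.sub (ae_eq_refl _))⟩

lemma tendsto_eLpNorm_clm_apply {B : X → F₁ →L[ℝ] F} {C : ℝ} (hC : ∀ᵐ x ∂μ, ‖B x‖ ≤ C)
    {f : ι → X → F₁} {f₀ : X → F₁} (h : Tendsto (fun i => eLpNorm (f i - f₀) p μ) l (𝓝 0)) :
    Tendsto (fun i => eLpNorm ((fun x => B x (f i x)) - fun x => B x (f₀ x)) p μ) l (𝓝 0) := by
  refine tendsto_of_tendsto_of_tendsto_of_le_of_le tendsto_const_nhds
    (by simpa only [mul_zero] using ENNReal.Tendsto.const_mul h (Or.inr ENNReal.ofReal_ne_top))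
    (fun _ => zero_le) fun i => eLpNorm_le_mul_eLpNorm_of_ae_le_mul (c := C) ?_ p
  filter_upwards [hC] with x hx
  rw [Pi.sub_apply, ← map_sub]
  exact (B x).le_of_opNorm_le hx _

lemma tendsto_integral_clm_apply [IsFiniteMeasure μ] {B : X → F₁ →L[ℝ] F} {C : ℝ}
    (hB : AEStronglyMeasurable B μ) (hC : ∀ᵐ x ∂μ, ‖B x‖ ≤ C) (hp : 1 ≤ p) {f : ι → X → F₁}
    {f₀ : X → F₁} (hf : ∀ i, Integrable (f i) μ) (hf₀ : Integrable f₀ μ)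
    (h : Tendsto (fun i => eLpNorm (f i - f₀) p μ) l (𝓝 0)) :
    Tendsto (fun i => ∫ x, B x (f i x) ∂μ) l (𝓝 (∫ x, B x (f₀ x) ∂μ)) := by
  have hBf (i : ι) := memLp_clm_apply hB hC (memLp_one_iff_integrable.2 (hf i))
  have hBf₀ := memLp_clm_apply hB hC (memLp_one_iff_integrable.2 hf₀)
  exact tendsto_integral_of_L1' _ hBf₀.1 (.of_forall fun i => memLp_one_iff_integrable.1 (hBf i))
    (tendsto_eLpNorm_of_exponent_le one_ne_zero hp (fun i => (hBf i).1.sub hBf₀.1)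
      (tendsto_eLpNorm_clm_apply hC h))

variable [p.HolderConjugate q] {B : X → F₁ →L[ℝ] F₂ →L[ℝ] ℝ} {C : ℝ}

lemma integrable_bilin (hB : AEStronglyMeasurable B μ) (hC : ∀ᵐ x ∂μ, ‖B x‖ ≤ C) {f : X → F₁}
    {g : X → F₂} (hf : MemLp f p μ) (hg : MemLp g q μ) :
    Integrable (fun x => B x (f x) (g x)) μ :=
  memLp_one_iff_integrable.1 <|
    (ContinuousLinearMap.id ℝ (F₂ →L[ℝ] ℝ)).memLp_of_bilin 1 (memLp_clm_apply hB hC hf) hg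

lemma tendsto_integral_bilin (hB : AEStronglyMeasurable B μ) (hC : ∀ᵐ x ∂μ, ‖B x‖ ≤ C)
    {f : ι → X → F₁} {g : ι → X → F₂} {f₀ : X → F₁} {g₀ : X → F₂}
    (hf : ∀ i, MemLp (f i) p μ) (hg : ∀ i, MemLp (g i) q μ) (hf₀ : MemLp f₀ p μ)
    (hg₀ : MemLp g₀ q μ) (hlf : Tendsto (fun i => eLpNorm (f i - f₀) p μ) l (𝓝 0))
    (hlg : Tendsto (fun i => eLpNorm (g i - g₀) q μ) l (𝓝 0)) :
    Tendsto (fun i => ∫ x, B x (f i x) (g i x) ∂μ) l (𝓝 (∫ x, B x (f₀ x) (g₀ x) ∂μ)) := by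
  have : Fact (1 ≤ p) := ⟨ENNReal.HolderConjugate.one_le p q⟩
  have : Fact (1 ≤ q) := ⟨ENNReal.HolderConjugate.one_le q p⟩
  have hBf (i : ι) := memLp_clm_apply hB hC (hf i)
  have hBf₀ := memLp_clm_apply hB hC hf₀
  obtain ⟨P, hP⟩ : ∃ P : Lp (F₂ →L[ℝ] ℝ) p μ →L[ℝ] Lp F₂ q μ →L[ℝ] ℝ,
      ∀ (a : X → F₂ →L[ℝ] ℝ) (ha : MemLp a p μ) (b : X → F₂) (hb : MemLp b q μ),
        P (ha.toLp a) (hb.toLp b) = ∫ x, a x (b x) ∂μ := by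
    refine ⟨(ContinuousLinearMap.id ℝ (F₂ →L[ℝ] ℝ)).lpPairing μ p q, fun a ha b hb => ?_⟩
    rw [ContinuousLinearMap.lpPairing_eq_integral]
    refine integral_congr_ae ?_
    filter_upwards [ha.coeFn_toLp, hb.coeFn_toLp] with x hax hbx
    rw [hax, hbx, ContinuousLinearMap.id_apply]
  have hlBf := (Lp.tendsto_Lp_iff_tendsto_eLpNorm'' _ hBf _ hBf₀).2
    (tendsto_eLpNorm_clm_apply hC hlf)
  have hlg := (Lp.tendsto_Lp_iff_tendsto_eLpNorm'' _ hg _ hg₀).2 hlg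
  have hlP := (P.continuous₂.tendsto (_, _)).comp (hlBf.prodMk_nhds hlg)
  simpa only [Function.comp_def, Function.uncurry, hP] using hlP

end Convergence

instance holderConjugate_three_halves_three : ENNReal.HolderConjugate (3 / 2) 3 where
  inv_add_inv_eq_inv := by
    rw [ENNReal.inv_div (by simp) (by simp), inv_one, ← one_div, ← ENNReal.add_div,
      show (2 : ℝ≥0∞) + 1 = 3 by norm_num, ENNReal.div_self (by simp) (by simp)]

lemma one_le_three_halves : (1 : ℝ≥0∞) ≤ 3 / 2 := ENNReal.HolderConjugate.one_le _ 3

lemma three_halves_le_two : (3 / 2 : ℝ≥0∞) ≤ 2 :=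
  ENNReal.div_le_of_le_mul (by norm_num)

instance isFiniteMeasure_restrict_ball (R : ℝ) :
    IsFiniteMeasure ((volume : Measure E3).restrict (ball 0 R)) :=
  isFiniteMeasure_restrict.2 measure_ball_lt_top.ne

section BoundedSupport

variable {μ : Measure E3} {R : ℝ}

lemma ae_restrict_ball_norm_le (R : ℝ) :
    ∀ᵐ x ∂((volume : Measure E3).restrict (ball 0 R)), ‖x‖ ≤ R :=
  ae_restrict_of_forall_mem measurableSet_ball fun _ hx => (mem_ball_zero_iff.1 hx).le

lemma exists_ae_norm_le_of_continuous {F : Type*} [NormedAddCommGroup F] {f : E3 → F}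
    (hf : Continuous f) (hμ : ∀ᵐ x ∂μ, ‖x‖ ≤ R) : ∃ C : ℝ, ∀ᵐ x ∂μ, ‖f x‖ ≤ C := by
  obtain ⟨C, hC⟩ := (isCompact_closedBall (0 : E3) R).exists_bound_of_continuousOn hf.continuousOn
  exact ⟨C, hμ.mono fun x hx => hC x (mem_closedBall_zero_iff.2 hx)⟩

lemma memLp_of_continuous [IsFiniteMeasure μ] {F : Type*} [NormedAddCommGroup F]
    [SecondCountableTopologyEither E3 F] {f : E3 → F} (hf : Continuous f)
    (hμ : ∀ᵐ x ∂μ, ‖x‖ ≤ R) (p : ℝ≥0∞) : MemLp f p μ :=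
  let ⟨C, hC⟩ := exists_ae_norm_le_of_continuous hf hμ
  .of_bound hf.aestronglyMeasurable C hC

variable {F₁ F₂ : Type*} [NormedAddCommGroup F₁] [NormedSpace ℝ F₁] [NormedAddCommGroup F₂]
  [NormedSpace ℝ F₂] {p q : ℝ≥0∞} [p.HolderConjugate q] {B : E3 → F₁ →L[ℝ] F₂ →L[ℝ] ℝ}

set_option maxSynthPendingDepth 3 in
lemma integrable_bilin_of_continuous (hB : Continuous B) (hμ : ∀ᵐ x ∂μ, ‖x‖ ≤ R)
    {f : E3 → F₁} {g : E3 → F₂} (hf : MemLp f p μ) (hg : MemLp g q μ) :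
    Integrable (fun x => B x (f x) (g x)) μ :=
  let ⟨_, hC⟩ := exists_ae_norm_le_of_continuous hB hμ
  integrable_bilin hB.aestronglyMeasurable hC hf hg

set_option maxSynthPendingDepth 3 in
lemma tendsto_integral_bilin_of_continuous (hB : Continuous B) (hμ : ∀ᵐ x ∂μ, ‖x‖ ≤ R)
    {ι : Type*} {l : Filter ι} {f : ι → E3 → F₁} {g : ι → E3 → F₂} {f₀ : E3 → F₁} {g₀ : E3 → F₂}
    (hf : ∀ i, MemLp (f i) p μ) (hg : ∀ i, MemLp (g i) q μ) (hf₀ : MemLp f₀ p μ)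
    (hg₀ : MemLp g₀ q μ) (hlf : Tendsto (fun i => eLpNorm (f i - f₀) p μ) l (𝓝 0))
    (hlg : Tendsto (fun i => eLpNorm (g i - g₀) q μ) l (𝓝 0)) :
    Tendsto (fun i => ∫ x, B x (f i x) (g i x) ∂μ) l (𝓝 (∫ x, B x (f₀ x) (g₀ x) ∂μ)) :=
  let ⟨_, hC⟩ := exists_ae_norm_le_of_continuous hB hμ
  tendsto_integral_bilin hB.aestronglyMeasurable hC hf hg hf₀ hg₀ hlf hlg

end BoundedSupport

section Forms

/-- The inner product of `E3` as a bilinear map; unlike `innerSL ℝ` it is not typed as a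
conjugate-linear map, so it can be added to and composed with bilinear forms. -/
def dot : E3 →L[ℝ] E3 →L[ℝ] ℝ := (innerₗ E3).toContinuousBilinearMap

/-- The bilinear form `(a, b) ↦ c (a · x) (b · x) + d (a · b)`, through which the quadratic terms
of the integral identities are expressed. -/
def radialForm (c d : ℝ) (x : E3) : E3 →L[ℝ] E3 →L[ℝ] ℝ :=
  c • (dot x).smulRight (dot x) + d • dot

/-- The bilinear form `(A, b) ↦ c (A x · b)`. -/
def radialDerivForm (c : ℝ) (x : E3) : (E3 →L[ℝ] E3) →L[ℝ] E3 →L[ℝ] ℝ :=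
  c • dot.comp (ContinuousLinearMap.apply ℝ E3 x)

/-- The bilinear form `(A, b) ↦ c * stressDiv x A b`. -/
def stressForm (c : ℝ) (x : E3) : (E3 →L[ℝ] E3) →L[ℝ] E3 →L[ℝ] ℝ :=
  c • (divCLM.smulRight (dot x) + ContinuousLinearMap.compL ℝ E3 E3 ℝ (dot x)
    - dot.comp (ContinuousLinearMap.apply ℝ E3 x))

lemma dot_apply (a b : E3) : dot a b = inner ℝ a b := rfl

lemma radialForm_apply_self (c d : ℝ) (x a : E3) :
    radialForm c d x a a = c * inner ℝ a x ^ 2 + d * ‖a‖ ^ 2 := by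
  simp [radialForm, dot_apply, real_inner_comm a x, sq]

lemma radialDerivForm_apply (c : ℝ) (x : E3) (A : E3 →L[ℝ] E3) (b : E3) :
    radialDerivForm c x A b = c * inner ℝ b (A x) := by
  simp [radialDerivForm, dot_apply, real_inner_comm b (A x)]

lemma stressForm_apply (c : ℝ) (x : E3) (A : E3 →L[ℝ] E3) (b : E3) :
    stressForm c x A b = c * stressDiv x A b := by
  change c * (divCLM A * dot x b + dot x (A b) - dot (A x) b) = _
  rw [divCLM_apply, dot_apply, dot_apply, dot_apply, real_inner_comm b, real_inner_comm b,
    stressDiv]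

variable {c d : E3 → ℝ}

lemma continuous_radialForm (hc : Continuous c) (hd : Continuous d) :
    Continuous fun x => radialForm (c x) (d x) x := by
  refine continuous_clm_apply.2 fun a => continuous_clm_apply.2 fun b => ?_
  simp only [radialForm, add_apply, smul_apply,
    ContinuousLinearMap.smulRight_apply, dot_apply]
  fun_prop

lemma continuous_radialDerivForm (hc : Continuous c) :
    Continuous fun x => radialDerivForm (c x) x := by
  unfold radialDerivForm
  fun_prop

lemma continuous_stressForm (hc : Continuous c) : Continuous fun x => stressForm (c x) x := by
  have hdiv := ((ContinuousLinearMap.smulRightL ℝ _ _ divCLM).comp dot).continuous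
  have hcomp := ((ContinuousLinearMap.compL ℝ E3 E3 ℝ).comp dot).continuous
  have happly := (((ContinuousLinearMap.compL ℝ (E3 →L[ℝ] E3) E3 _ dot)).comp
    (ContinuousLinearMap.apply ℝ E3)).continuous
  exact hc.smul ((hdiv.add hcomp).sub happly)

end Forms

section Approximation

variable {ι : Type*} {l : Filter ι} {u : E3 → E3} {G : E3 → E3 →L[ℝ] E3} {R : ℝ} {g : E3 → E3}
  {B : E3 → (E3 →L[ℝ] E3) →L[ℝ] E3 →L[ℝ] ℝ} {P Q : E3 → E3 →L[ℝ] E3 →L[ℝ] ℝ}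

lemma tendsto_setIntegral_bilin_add_quadratic {v : ι → E3 → E3} {A : ι → E3 → E3 →L[ℝ] E3}
    (hB : Continuous B) (hQ : Continuous Q)
    (hv : ∀ i, MemLp (v i) 3 (volume.restrict (ball 0 R)))
    (hA : ∀ i, MemLp (A i) (3 / 2) (volume.restrict (ball 0 R)))
    (hu : MemLp u 3 (volume.restrict (ball 0 R)))
    (hG : MemLp G (3 / 2) (volume.restrict (ball 0 R)))
    (hlv : Tendsto (fun i => eLpNorm (v i - u) 3 (volume.restrict (ball 0 R))) l (𝓝 0))
    (hlA : Tendsto (fun i => eLpNorm (A i - G) (3 / 2) (volume.restrict (ball 0 R))) l (𝓝 0)) :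
    Tendsto (fun i => ∫ x in ball 0 R, (B x (A i x) (v i x) + Q x (v i x) (v i x))) l
      (𝓝 (∫ x in ball 0 R, (B x (G x) (u x) + Q x (u x) (u x)))) := by
  have h23 : (2 : ℝ≥0∞) ≤ 3 := by norm_num
  have hball := ae_restrict_ball_norm_le R
  have hv2 (i : ι) := (hv i).mono_exponent h23
  have hu2 := hu.mono_exponent h23
  have hlv2 := tendsto_eLpNorm_of_exponent_le two_ne_zero h23 (fun i => (hv i).1.sub hu.1) hlv
  have hlim := (tendsto_integral_bilin_of_continuous hB hball hA hv hG hu hlA hlv).add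
    (tendsto_integral_bilin_of_continuous hQ hball hv2 hv2 hu2 hu2 hlv2 hlv2)
  rw [← integral_add (integrable_bilin_of_continuous hB hball hG hu)
    (integrable_bilin_of_continuous hQ hball hu2 hu2)] at hlim
  exact hlim.congr fun i => (integral_add (integrable_bilin_of_continuous hB hball (hA i) (hv i))
    (integrable_bilin_of_continuous hQ hball (hv2 i) (hv2 i))).symm

variable (u G R g) in
/-- Smooth vector fields `v n` approximating `u` in `L³` and its weak derivative `G` in `L^{3/2}`
of the ball of radius `R`, whose restrictions to the sphere converge to `g` in `L²`: the setting
in which the integral identities for smooth fields pass to the limit. -/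
structure SmoothApprox (v : ℕ → E3 → E3) : Prop where
  pos : 0 < R
  contDiff : ∀ n, ContDiff ℝ ∞ (v n)
  memLp_three : MemLp u 3 (volume.restrict (ball 0 R))
  memLp_deriv : MemLp G (3 / 2) (volume.restrict (ball 0 R))
  memLp_trace : MemLp g 2 (surfaceMeasure R)
  tendsto_three : Tendsto (fun n => eLpNorm (v n - u) 3 (volume.restrict (ball 0 R))) atTop (𝓝 0)
  tendsto_deriv : Tendsto (fun n => eLpNorm (fderiv ℝ (v n) - G) (3 / 2)
    (volume.restrict (ball 0 R))) atTop (𝓝 0)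
  tendsto_trace : Tendsto (fun n => eLpNorm (v n - g) 2 (surfaceMeasure R)) atTop (𝓝 0)

lemma SmoothApprox.setIntegral_eq {v : ℕ → E3 → E3} (h : SmoothApprox u G R g v)
    (hB : Continuous B) (hQ : Continuous Q) (hP : Continuous P)
    (hid : ∀ w : E3 → E3, ContDiff ℝ 1 w →
      ∫ x in ball 0 R, (B x (fderiv ℝ w x) (w x) + Q x (w x) (w x))
        = ∫ x, P x (w x) (w x) ∂(surfaceMeasure R)) :
    ∫ x in ball 0 R, (B x (G x) (u x) + Q x (u x) (u x))
      = ∫ x, P x (g x) (g x) ∂(surfaceMeasure R) := by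
  have hball := ae_restrict_ball_norm_le R
  have hsphere := ae_surfaceMeasure_norm_le h.pos
  have hv1 (n : ℕ) : ContDiff ℝ 1 (v n) := (h.contDiff n).of_le (mod_cast le_top)
  have hvc (n : ℕ) : Continuous (v n) := (hv1 n).continuous
  have hvd (n : ℕ) : Continuous (fderiv ℝ (v n)) := (hv1 n).continuous_fderiv one_ne_zero
  refine tendsto_nhds_unique (tendsto_setIntegral_bilin_add_quadratic hB hQ
    (fun n => memLp_of_continuous (hvc n) hball 3)
    (fun n => memLp_of_continuous (hvd n) hball (3 / 2)) h.memLp_three h.memLp_deriv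
    h.tendsto_three h.tendsto_deriv) ?_
  simp only [fun n => hid (v n) (hv1 n)]
  have hvs (n : ℕ) : MemLp (v n) 2 (surfaceMeasure R) := memLp_of_continuous (hvc n) hsphere 2
  exact tendsto_integral_bilin_of_continuous hP hsphere hvs hvs h.memLp_trace h.memLp_trace
    h.tendsto_trace h.tendsto_trace

variable {v : ℕ → E3 → E3} {m k : E3 → ℝ}

theorem SmoothApprox.setIntegral_ball_mul_norm_sq (h : SmoothApprox u G R g v)
    (hk : Continuous k) (hmc : ContDiff ℝ 1 m)
    (hm : ∀ x, HasFDerivAt m (k x • innerSL ℝ x) x) :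
    ∫ x in ball 0 R, (2 * m x * inner ℝ (u x) (G x x) + (3 * m x + k x * ‖x‖ ^ 2) * ‖u x‖ ^ 2)
      = ∫ x, R * m x * ‖g x‖ ^ 2 ∂(surfaceMeasure R) := by
  have hmcont := hmc.continuous
  have hB := continuous_radialDerivForm (c := fun x => 2 * m x) (by fun_prop)
  have hQ := continuous_radialForm (c := 0) (d := fun x => 3 * m x + k x * ‖x‖ ^ 2)
    continuous_zero (by fun_prop)
  have hP := continuous_radialForm (c := 0) (d := fun x => R * m x) continuous_zero (by fun_prop)
  simpa only [radialDerivForm_apply, radialForm_apply_self, Pi.zero_apply, zero_mul, zero_add]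
    using h.setIntegral_eq hB hQ hP fun w hw => by
      simpa only [radialDerivForm_apply, radialForm_apply_self, Pi.zero_apply, zero_mul, zero_add]
        using Beltrami.setIntegral_ball_mul_norm_sq hw hmc hm h.pos

theorem SmoothApprox.setIntegral_ball_of_stressDiv_eq_zero (h : SmoothApprox u G R g v)
    (hG : ∀ᵐ x, stressDiv x (G x) (u x) = 0) (hk : Continuous k) (hmc : ContDiff ℝ 1 m)
    (hm : ∀ x, HasFDerivAt m (k x • innerSL ℝ x) x) :
    ∫ x in ball 0 R, (R * k x * inner ℝ (u x) x ^ 2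
        - R * (k x * ‖x‖ ^ 2 + m x) / 2 * ‖u x‖ ^ 2)
      = ∫ x, (m x * inner ℝ (g x) x ^ 2 - m x * ‖x‖ ^ 2 / 2 * ‖g x‖ ^ 2) ∂(surfaceMeasure R) := by
  have hmcont := hmc.continuous
  have hB := continuous_stressForm (c := fun x => R * m x) (by fun_prop)
  have hQ := continuous_radialForm (c := fun x => R * k x)
    (d := fun x => -(R * (k x * ‖x‖ ^ 2 + m x) / 2)) (by fun_prop) (by fun_prop)
  have hP := continuous_radialForm (c := m) (d := fun x => -(m x * ‖x‖ ^ 2 / 2)) hmcont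
    (by fun_prop)
  have hlim := h.setIntegral_eq hB hQ hP fun w hw => by
    simpa only [stressForm_apply, radialForm_apply_self, neg_mul, ← sub_eq_add_neg]
      using setIntegral_ball_stressDiv hw hmc hm h.pos
  simp only [stressForm_apply, radialForm_apply_self, neg_mul, ← sub_eq_add_neg] at hlim
  rw [← hlim]
  refine integral_congr_ae ?_
  filter_upwards [ae_restrict_of_ae hG] with x hx
  rw [hx, mul_zero, zero_add]

end Approximation

section Trace

variable {u : E3 → E3} {G : E3 → E3 →L[ℝ] E3} {R : ℝ} {v : ℕ → E3 → E3} {g : E3 → E3}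
  {p : ℝ≥0∞}

lemma tendsto_eLpNorm_two_of_tendsto_integral {X F ι : Type*} [MeasurableSpace X]
    {μ : Measure X} [NormedAddCommGroup F] {l : Filter ι} {f : ι → X → F}
    (hf : ∀ i, MemLp (f i) 2 μ) (h : Tendsto (fun i => ∫ x, ‖f i x‖ ^ 2 ∂μ) l (𝓝 0)) :
    Tendsto (fun i => eLpNorm (f i) 2 μ) l (𝓝 0) := by
  have hroot := ENNReal.tendsto_ofReal (h.rpow_const (p := (2 : ℝ)⁻¹) (Or.inr (by norm_num)))
  rw [Real.zero_rpow (by norm_num), ENNReal.ofReal_zero] at hroot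
  refine hroot.congr fun i => ?_
  rw [(hf i).eLpNorm_eq_integral_rpow_norm two_ne_zero ENNReal.ofNat_ne_top]
  simp only [ENNReal.toReal_ofNat, Real.rpow_ofNat]

lemma tendsto_integral_surfaceMeasure_norm_sq {ι : Type*} {l : Filter ι} {w : ι → E3 → E3}
    (hR : 0 < R) (hw : ∀ i, ContDiff ℝ 1 (w i))
    (h : Tendsto (fun i => eLpNorm (w i) 3 (volume.restrict (ball 0 R))) l (𝓝 0))
    (h' : Tendsto (fun i => eLpNorm (fderiv ℝ (w i)) (3 / 2) (volume.restrict (ball 0 R))) l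
      (𝓝 0)) :
    Tendsto (fun i => ∫ x, ‖w i x‖ ^ 2 ∂(surfaceMeasure R)) l (𝓝 0) := by
  have hball := ae_restrict_ball_norm_le R
  have hB := continuous_radialDerivForm (c := fun _ => 2) continuous_const
  have hQ := continuous_radialForm (c := fun _ => 0) (d := fun _ => 3) continuous_const
    continuous_const
  have hwp (i : ι) : MemLp (w i) 3 (volume.restrict (ball 0 R)) :=
    memLp_of_continuous (hw i).continuous hball 3
  have hwd (i : ι) : MemLp (fderiv ℝ (w i)) (3 / 2) (volume.restrict (ball 0 R)) :=
    memLp_of_continuous ((hw i).continuous_fderiv one_ne_zero) hball (3 / 2)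
  have hlim := tendsto_setIntegral_bilin_add_quadratic (u := 0) (G := 0) hB hQ hwp hwd
    (memLp_of_continuous continuous_zero hball 3)
    (memLp_of_continuous continuous_zero hball (3 / 2))
    (by simpa only [sub_zero] using h) (by simpa only [sub_zero] using h')
  have hid (i : ι) := setIntegral_ball_mul_norm_sq (m := fun _ => 1) (k := fun _ => 0) (hw i)
    contDiff_const (fun x => by simpa using hasFDerivAt_const (1 : ℝ) x) hR
  simp only [mul_one, zero_mul, add_zero, integral_const_mul] at hid
  simp only [radialDerivForm_apply, radialForm_apply_self, Pi.zero_apply, zero_mul, zero_add,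
    hid, zero_apply, inner_zero_left, norm_zero, mul_zero, integral_zero, ne_eq,
    OfNat.ofNat_ne_zero, not_false_eq_true, zero_pow, add_zero] at hlim
  simpa only [inv_mul_cancel_left₀ hR.ne', mul_zero] using hlim.const_mul R⁻¹

theorem exists_smoothApprox (h : HasWeakDeriv u G) (hu : MemLpLoc u (3 / 2))
    (hG : MemLpLoc G (3 / 2)) (hR : 0 < R) : ∃ g v, SmoothApprox u G R g v := by
  have hcoe : ((3 / 2 : NNReal) : ℝ≥0∞) = 3 / 2 := by
    rw [ENNReal.coe_div (by norm_num)]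
    rfl
  obtain ⟨hu3, v, hv, hlv, hlv'⟩ := h.exists_contDiff_tendsto (p := 3 / 2) (q := 3)
    (by rw [← NNReal.coe_le_coe]; norm_num) (by norm_num) (by norm_num) (hcoe ▸ hu) (hcoe ▸ hG) R
  rw [hcoe] at hlv'
  have hGp : MemLp G (3 / 2) (volume.restrict (ball 0 R)) :=
    (hG _ (isCompact_closedBall 0 R)).mono_measure
      (Measure.restrict_mono_set _ ball_subset_closedBall)
  have hv1 (n : ℕ) : ContDiff ℝ 1 (v n) := (hv n).of_le (mod_cast le_top)
  have hvc (n : ℕ) : Continuous (fderiv ℝ (v n)) := (hv1 n).continuous_fderiv one_ne_zero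
  have hfderiv (n : ℕ × ℕ) :
      fderiv ℝ (v n.1 - v n.2) = fderiv ℝ (v n.1) - fderiv ℝ (v n.2) := funext fun x =>
    fderiv_sub ((hv1 _).differentiable one_ne_zero x) ((hv1 _).differentiable one_ne_zero x)
  have hvS (n : ℕ) : MemLp (v n) 2 (surfaceMeasure R) :=
    memLp_of_continuous (hv n).continuous (ae_surfaceMeasure_norm_le hR) 2
  have hDcauchy := tendsto_eLpNorm_sub_sub one_le_three_halves
    (fun n => (hvc n).aestronglyMeasurable) hGp.1 hlv'
  obtain ⟨g, hg, hlg⟩ := exists_memLp_tendsto hvS <|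
    tendsto_eLpNorm_two_of_tendsto_integral (fun n => (hvS n.1).sub (hvS n.2)) <|
    tendsto_integral_surfaceMeasure_norm_sq hR (fun n => (hv1 n.1).sub (hv1 n.2))
      (tendsto_eLpNorm_sub_sub (by norm_num) (fun n => (hv n).continuous.aestronglyMeasurable)
        hu3.1 hlv)
      (hDcauchy.congr fun n => by rw [hfderiv])
  exact ⟨g, v, hR, hv, hu3, hGp, hg, hlv, hlv', hlg⟩

lemma SmoothApprox.isSphereTrace (h : SmoothApprox u G R g v) (hG : HasWeakDeriv u G) :
    IsSphereTrace (3 / 2) u R g :=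
  ⟨h.memLp_trace.mono_exponent three_halves_le_two, G, hG, v, h.contDiff,
    tendsto_eLpNorm_of_exponent_le (zero_lt_one.trans_le one_le_three_halves).ne'
      (three_halves_le_two.trans (by norm_num))
      (fun n => (h.contDiff n).continuous.aestronglyMeasurable.sub h.memLp_three.1)
      h.tendsto_three,
    h.tendsto_deriv,
    tendsto_eLpNorm_of_exponent_le (zero_lt_one.trans_le one_le_three_halves).ne'
      three_halves_le_two
      (fun n => (h.contDiff n).continuous.aestronglyMeasurable.sub h.memLp_trace.1)
      h.tendsto_trace⟩

lemma SmoothApprox.congr_trace (h : SmoothApprox u G R g v) {g' : E3 → E3}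
    (hg : g =ᵐ[surfaceMeasure R] g') : SmoothApprox u G R g' v :=
  { h with
    memLp_trace := h.memLp_trace.ae_eq hg
    tendsto_trace := h.tendsto_trace.congr fun _ => eLpNorm_congr_ae ((ae_eq_refl _).sub hg) }

lemma integrableOn_ball_of_locallyIntegrable {F : Type*} [NormedAddCommGroup F] {f : E3 → F}
    (hf : LocallyIntegrable f volume) (R : ℝ) : IntegrableOn f (ball 0 R) :=
  (hf.integrableOn_isCompact (isCompact_closedBall 0 R)).mono_set ball_subset_closedBall

lemma tendsto_integral_clm_apply_of_continuous {F F' : Type*} [NormedAddCommGroup F]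
    [NormedSpace ℝ F] [NormedAddCommGroup F'] [NormedSpace ℝ F']
    [SecondCountableTopology F] {μ : Measure E3} [IsFiniteMeasure μ] {B : E3 → F →L[ℝ] F'}
    (hB : Continuous B) (hμ : ∀ᵐ x ∂μ, ‖x‖ ≤ R) (hp : 1 ≤ p) {f : ℕ → E3 → F} {f₀ : E3 → F}
    (hf : ∀ n, Continuous (f n)) (hf₀ : Integrable f₀ μ)
    (h : Tendsto (fun n => eLpNorm (f n - f₀) p μ) atTop (𝓝 0)) :
    Tendsto (fun n => ∫ x, B x (f n x) ∂μ) atTop (𝓝 (∫ x, B x (f₀ x) ∂μ)) :=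
  let ⟨_, hC⟩ := exists_ae_norm_le_of_continuous hB hμ
  tendsto_integral_clm_apply hB.aestronglyMeasurable hC hp
    (fun n => memLp_one_iff_integrable.1 (memLp_of_continuous (hf n) hμ 1)) hf₀ h

lemma setIntegral_ball_smul_add_smul_fderiv {φ : E3 → ℝ} {w : E3 → E3} (hφ : ContDiff ℝ 1 φ)
    (hw : ContDiff ℝ 1 w) (hR : 0 < R) :
    (∫ x in ball 0 R, (3 * φ x + fderiv ℝ φ x x) • w x) + ∫ x in ball 0 R, φ x • fderiv ℝ w x x
      = R • ∫ x, φ x • w x ∂(surfaceMeasure R) := by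
  have hball := ae_restrict_ball_norm_le R
  have hφc := hφ.continuous
  have hwc := hw.continuous
  rw [← setIntegral_ball_three_smul_add_fderiv (hφ.fun_smul hw) hR, ← integral_add]
  · congr 1 with x : 1
    rw [fderiv_fun_smul (hφ.differentiable one_ne_zero x) (hw.differentiable one_ne_zero x)]
    simp only [add_apply, smul_apply, ContinuousLinearMap.smulRight_apply]
    module
  · exact (memLp_of_continuous (by fun_prop) hball 1).integrable le_rfl
  · exact (memLp_of_continuous (by fun_prop) hball 1).integrable le_rfl

/-- The divergence theorem for `φ • u`, which expresses the trace through `u` and `G` alone. -/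
lemma IsSphereTrace.smul_integral_smul_eq (h : IsSphereTrace p u R g) (hG : HasWeakDeriv u G)
    (hp : 1 ≤ p) (hR : 0 < R) {φ : E3 → ℝ} (hφ : ContDiff ℝ 1 φ) :
    R • ∫ x, φ x • g x ∂(surfaceMeasure R)
      = (∫ x in ball 0 R, (3 * φ x + fderiv ℝ φ x x) • u x) + ∫ x in ball 0 R, φ x • G x x := by
  obtain ⟨hg, G', hG', w, hw, hlw, hlw', hlg⟩ := h
  have hball := ae_restrict_ball_norm_le R
  have hw1 (n : ℕ) : ContDiff ℝ 1 (w n) := (hw n).of_le (mod_cast le_top)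
  have hwc (n : ℕ) : Continuous (w n) := (hw n).continuous
  have hwd (n : ℕ) : Continuous (fderiv ℝ (w n)) := (hw1 n).continuous_fderiv one_ne_zero
  have hφc := hφ.continuous
  have hA : Continuous fun x => (3 * φ x + fderiv ℝ φ x x) • ContinuousLinearMap.id ℝ E3 := by
    fun_prop
  have hB : Continuous fun x => φ x • ContinuousLinearMap.apply ℝ E3 x := by fun_prop
  have hC : Continuous fun x => φ x • ContinuousLinearMap.id ℝ E3 := by fun_prop
  have hlimA := tendsto_integral_clm_apply_of_continuous hA hball hp hwc
    (integrableOn_ball_of_locallyIntegrable hG.locallyIntegrable R) hlw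
  have hlimB := tendsto_integral_clm_apply_of_continuous hB hball hp hwd
    (integrableOn_ball_of_locallyIntegrable hG.locallyIntegrable_deriv R) (hlw'.congr fun n =>
      eLpNorm_congr_ae ((ae_eq_refl _).sub (ae_restrict_of_ae (hG'.ae_eq hG))))
  have hlimC := tendsto_integral_clm_apply_of_continuous hC (ae_surfaceMeasure_norm_le hR) hp hwc
    (hg.integrable hp) hlg
  refine tendsto_nhds_unique (hlimC.const_smul R) ((hlimA.add hlimB).congr fun n => ?_)
  simp only [smul_apply, ContinuousLinearMap.id_apply, ContinuousLinearMap.apply_apply]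
  exact setIntegral_ball_smul_add_smul_fderiv hφ (hw1 n) hR

theorem IsSphereTrace.ae_eq {q : ℝ≥0∞} {g' : E3 → E3} (h : IsSphereTrace p u R g)
    (h' : IsSphereTrace q u R g') (hp : 1 ≤ p) (hq : 1 ≤ q) (hR : 0 < R) :
    g =ᵐ[surfaceMeasure R] g' := by
  obtain ⟨G, hG, -⟩ := h.2
  refine ae_eq_of_integral_contDiff_smul_eq (h.1.integrable hp).locallyIntegrable
    (h'.1.integrable hq).locallyIntegrable fun φ hφ _ => smul_right_injective E3 hR.ne' ?_
  have hφ1 : ContDiff ℝ 1 φ := hφ.of_le (mod_cast le_top)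
  exact (h.smul_integral_smul_eq hG hp hR hφ1).trans
    (h'.smul_integral_smul_eq hG hq hR hφ1).symm

end Trace

section RegularizedWeights

variable {ε b R α : ℝ} {x : E3}

variable (ε b x) in
/-- The smooth radial weight `(|x|² + ε²)^b`, a regularization of `|x|^(2b)`. -/
def regPow : ℝ := (‖x‖ ^ 2 + ε ^ 2) ^ b

lemma norm_sq_add_sq_pos (hε : 0 < ε) (x : E3) : 0 < ‖x‖ ^ 2 + ε ^ 2 := by positivity

lemma contDiff_regPow (hε : 0 < ε) (b : ℝ) : ContDiff ℝ 1 (regPow ε b) :=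
  ((contDiff_norm_sq ℝ).add contDiff_const).rpow_const_of_ne fun x => (norm_sq_add_sq_pos hε x).ne'

lemma continuous_regPow (hε : 0 < ε) (b : ℝ) : Continuous (regPow ε b) :=
  (contDiff_regPow hε b).continuous

lemma hasFDerivAt_regPow (hε : 0 < ε) (b : ℝ) (x : E3) :
    HasFDerivAt (regPow ε b) ((2 * b * regPow ε (b - 1) x) • innerSL ℝ x) x := by
  have h := ((hasStrictFDerivAt_norm_sq x).hasFDerivAt.add_const (ε ^ 2)).rpow_const
    (p := b) (Or.inl (norm_sq_add_sq_pos hε x).ne')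
  refine h.congr_fderiv ?_
  rw [regPow, ← Nat.cast_smul_eq_nsmul ℝ, smul_smul]
  ring_nf

lemma regPow_pos (hε : 0 < ε) (b : ℝ) (x : E3) : 0 < regPow ε b x :=
  Real.rpow_pos_of_pos (norm_sq_add_sq_pos hε x) b

lemma regPow_sub_one_mul_norm_sq_le (hε : 0 < ε) (b : ℝ) (x : E3) :
    regPow ε (b - 1) x * ‖x‖ ^ 2 ≤ regPow ε b x := by
  have hpos := norm_sq_add_sq_pos hε x
  calc regPow ε (b - 1) x * ‖x‖ ^ 2 ≤ regPow ε (b - 1) x * (‖x‖ ^ 2 + ε ^ 2) :=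
        mul_le_mul_of_nonneg_left (le_add_of_nonneg_right (sq_nonneg ε)) (regPow_pos hε _ x).le
    _ = regPow ε b x := by
        rw [regPow, regPow, Real.rpow_sub_one hpos.ne', div_mul_cancel₀ _ hpos.ne']

lemma norm_sq_rpow (b : ℝ) (x : E3) : (‖x‖ ^ 2) ^ b = ‖x‖ ^ (2 * b) := by
  rw [Real.rpow_mul (norm_nonneg x), Real.rpow_two]

lemma regPow_le_of_nonpos (hb : b ≤ 0) (hx : x ≠ 0) : regPow ε b x ≤ ‖x‖ ^ (2 * b) := by
  rw [← norm_sq_rpow]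
  exact Real.rpow_le_rpow_of_nonpos (pow_pos (norm_pos_iff.2 hx) 2)
    (le_add_of_nonneg_right (sq_nonneg ε)) hb

lemma regPow_le_of_nonneg (hε : 0 ≤ ε) (hε1 : ε ≤ 1) (hb : 0 ≤ b) (hx : ‖x‖ ≤ R) :
    regPow ε b x ≤ (R ^ 2 + 1) ^ b := by
  refine Real.rpow_le_rpow (by positivity) (add_le_add ?_ (pow_le_one₀ hε hε1)) hb
  gcongr

lemma regPow_le_add (hε : 0 ≤ ε) (hε1 : ε ≤ 1) (hx : x ≠ 0) (hxR : ‖x‖ ≤ R) :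
    regPow ε b x ≤ ‖x‖ ^ (2 * b) + (R ^ 2 + 1) ^ b := by
  rcases le_total b 0 with hb | hb
  · exact (regPow_le_of_nonpos hb hx).trans (le_add_of_nonneg_right (by positivity))
  · exact (regPow_le_of_nonneg hε hε1 hb hxR).trans (le_add_of_nonneg_left (by positivity))

lemma regPow_neg_half_mul_norm_le_one (ε : ℝ) (x : E3) : regPow ε (-1 / 2) x * ‖x‖ ≤ 1 := by
  rcases eq_or_ne x 0 with rfl | hx
  · simp
  · have h := regPow_le_of_nonpos (ε := ε) (b := -1 / 2) (by norm_num) hx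
    rw [show (2 * (-1 / 2) : ℝ) = -1 by norm_num, Real.rpow_neg_one] at h
    calc regPow ε (-1 / 2) x * ‖x‖ ≤ ‖x‖⁻¹ * ‖x‖ := by gcongr
      _ = 1 := inv_mul_cancel₀ (norm_ne_zero_iff.2 hx)

lemma tendsto_regPow (b : ℝ) (hx : x ≠ 0) :
    Tendsto (fun ε => regPow ε b x) (𝓝[>] 0) (𝓝 (‖x‖ ^ (2 * b))) := by
  have hne : ‖x‖ ^ 2 + (0 : ℝ) ^ 2 ≠ 0 := by simpa using hx
  have hcont : ContinuousAt (fun ε : ℝ => (‖x‖ ^ 2 + ε ^ 2) ^ b) 0 :=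
    ContinuousAt.rpow_const (by fun_prop) (Or.inl hne)
  simpa [regPow, norm_sq_rpow] using hcont.tendsto.mono_left nhdsWithin_le_nhds

variable (ε b x) in
/-- The density of the bulk integral in the identity
`SmoothApprox.setIntegral_ball_of_stressDiv_eq_zero` for the weight `regPow ε b`, at a point `x`
where the field has the value `a`, and without the factor `R`. -/
def regDensity (a : E3) : ℝ :=
  2 * b * regPow ε (b - 1) x * inner ℝ a x ^ 2
    - (2 * b * regPow ε (b - 1) x * ‖x‖ ^ 2 + regPow ε b x) / 2 * ‖a‖ ^ 2

lemma abs_regDensity_le (hε : 0 < ε) (b : ℝ) (x a : E3) :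
    |regDensity ε b x a| ≤ (|b| + 1 / 2) * (regPow ε b x * ‖a‖ ^ 2) := by
  set k := regPow ε (b - 1) x
  set M := regPow ε b x * ‖a‖ ^ 2
  have hk : 0 < k := regPow_pos hε _ x
  have hM : 0 ≤ M := mul_nonneg (regPow_pos hε _ x).le (sq_nonneg _)
  have hinner : inner ℝ a x ^ 2 ≤ ‖x‖ ^ 2 * ‖a‖ ^ 2 := by
    rw [mul_comm, ← mul_pow, sq_le_sq, abs_of_nonneg (by positivity : 0 ≤ ‖a‖ * ‖x‖)]
    exact abs_real_inner_le_norm a x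
  have hle : k * ‖x‖ ^ 2 * ‖a‖ ^ 2 ≤ M :=
    mul_le_mul_of_nonneg_right (regPow_sub_one_mul_norm_sq_le hε b x) (sq_nonneg _)
  have hkinner := mul_le_mul_of_nonneg_left hinner hk.le
  have hdev : |2 * (k * inner ℝ a x ^ 2) - k * ‖x‖ ^ 2 * ‖a‖ ^ 2| ≤ M := by
    have : 0 ≤ k * inner ℝ a x ^ 2 := by positivity
    rw [abs_le]
    constructor <;> linarith
  calc |regDensity ε b x a|
      = |b * (2 * (k * inner ℝ a x ^ 2) - k * ‖x‖ ^ 2 * ‖a‖ ^ 2) - M / 2| := by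
        congr 1
        simp only [regDensity, M, k]
        ring
    _ ≤ |b| * |2 * (k * inner ℝ a x ^ 2) - k * ‖x‖ ^ 2 * ‖a‖ ^ 2| + M / 2 := by
        rw [sub_eq_add_neg _ (M / 2), ← abs_mul]
        refine (abs_add_le _ _).trans_eq ?_
        rw [abs_neg, abs_of_nonneg (div_nonneg hM zero_le_two)]
    _ ≤ |b| * M + M / 2 := by gcongr
    _ = (|b| + 1 / 2) * M := by ring

end RegularizedWeights

section RadialDecomposition

lemma norm_normalPart_sq (u : E3 → E3) (x : E3) :
    ‖normalPart u x‖ ^ 2 = inner ℝ (u x) x ^ 2 / ‖x‖ ^ 2 := by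
  rcases eq_or_ne x 0 with rfl | hx
  · simp [normalPart]
  · have : ‖x‖ ≠ 0 := norm_ne_zero_iff.2 hx
    simp only [normalPart, inner_smul_right, norm_smul, norm_mul, norm_inv,
      Real.norm_eq_abs, mul_pow, sq_abs, inv_pow]
    field_simp

lemma norm_tangentialPart_sq (u : E3 → E3) (x : E3) :
    ‖tangentialPart u x‖ ^ 2 = ‖u x‖ ^ 2 - ‖normalPart u x‖ ^ 2 := by
  have hinner : inner ℝ (u x) (normalPart u x) = ‖normalPart u x‖ ^ 2 := by
    rw [norm_normalPart_sq, normalPart, inner_smul_right, inner_smul_right]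
    ring
  rw [tangentialPart, norm_sub_sq_real, hinner]
  ring

lemma norm_normalPart_le (u : E3 → E3) (x : E3) : ‖normalPart u x‖ ≤ ‖u x‖ := by
  refine le_of_sq_le_sq ?_ (norm_nonneg _)
  linarith [norm_tangentialPart_sq u x, sq_nonneg ‖tangentialPart u x‖]

lemma aestronglyMeasurable_normalPart {μ : Measure E3} {u : E3 → E3}
    (hu : AEStronglyMeasurable u μ) : AEStronglyMeasurable (normalPart u) μ := by
  have hr : AEStronglyMeasurable (fun x : E3 => ‖x‖⁻¹ • x) μ :=
    (measurable_norm.inv.smul measurable_id).aestronglyMeasurable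
  exact (AEStronglyMeasurable.inner (𝕜 := ℝ) hu hr).smul hr

lemma tendsto_regDensity (u : E3 → E3) {x : E3} (hx : x ≠ 0) (α : ℝ) :
    Tendsto (fun ε => regDensity ε (-α / 2) x (u x)) (𝓝[>] 0)
      (𝓝 ((α - 1) / 2 * (‖u x‖ ^ 2 / ‖x‖ ^ α) - α * (‖normalPart u x‖ ^ 2 / ‖x‖ ^ α))) := by
  have hx0 : 0 < ‖x‖ := norm_pos_iff.2 hx
  have hm := tendsto_regPow (-α / 2) hx
  have hk := (tendsto_regPow (-α / 2 - 1) hx).const_mul (2 * (-α / 2))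
  have hlim : Tendsto (fun ε => regDensity ε (-α / 2) x (u x)) _ _ :=
    (hk.mul_const (inner ℝ (u x) x ^ 2)).sub
      ((((hk.mul_const (‖x‖ ^ 2)).add hm).div_const 2).mul_const (‖u x‖ ^ 2))
  convert hlim using 2
  rw [norm_normalPart_sq, show 2 * (-α / 2) = -α by ring,
    show 2 * (-α / 2 - 1) = -α - 2 by ring, Real.rpow_sub hx0, Real.rpow_neg hx0.le, Real.rpow_two]
  have := Real.rpow_pos_of_pos hx0 α
  field_simp
  ring

end RadialDecomposition

section Hardy

variable {u : E3 → E3} {G : E3 → E3 →L[ℝ] E3} {R α : ℝ} {v : ℕ → E3 → E3} {g : E3 → E3}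

lemma integrable_mul_norm_sq {μ : Measure E3} (hμ : ∀ᵐ x ∂μ, ‖x‖ ≤ R) {w : E3 → ℝ}
    (hw : Continuous w) (hu : MemLp u 2 μ) : Integrable (fun x => w x * ‖u x‖ ^ 2) μ := by
  have hQ := continuous_radialForm (c := fun _ => 0) continuous_const hw
  simpa only [radialForm_apply_self, zero_mul, zero_add] using
    integrable_bilin_of_continuous hQ hμ hu hu

lemma SmoothApprox.memLp_two (h : SmoothApprox u G R g v) :
    MemLp u 2 (volume.restrict (ball 0 R)) :=
  h.memLp_three.mono_exponent (by norm_num)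

lemma SmoothApprox.integrableOn_mul_norm_sq (h : SmoothApprox u G R g v) {w : E3 → ℝ}
    (hw : Continuous w) : IntegrableOn (fun x => w x * ‖u x‖ ^ 2) (ball 0 R) :=
  integrable_mul_norm_sq (ae_restrict_ball_norm_le R) hw h.memLp_two

lemma neg_mul_inner_clm_le {c : ℝ} {x : E3} (hc : 0 ≤ c) (hcx : c * ‖x‖ ≤ 1) (A : E3 →L[ℝ] E3)
    (a : E3) : -(c * inner ℝ a (A x)) ≤ ‖a‖ * ‖A‖ :=
  calc -(c * inner ℝ a (A x)) = c * -inner ℝ a (A x) := by ring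
    _ ≤ c * (‖a‖ * ‖A x‖) := by
      gcongr
      exact (neg_le_abs _).trans (abs_real_inner_le_norm _ _)
    _ ≤ c * (‖a‖ * (‖A‖ * ‖x‖)) := by
      gcongr
      exact A.le_opNorm x
    _ = (c * ‖x‖) * (‖a‖ * ‖A‖) := by ring
    _ ≤ ‖a‖ * ‖A‖ := mul_le_of_le_one_left (by positivity) hcx

lemma SmoothApprox.setIntegral_mul_norm_sq_le (h : SmoothApprox u G R g v) {m k : E3 → ℝ}
    (hk : Continuous k) (hmc : ContDiff ℝ 1 m) (hm : ∀ x, HasFDerivAt m (k x • innerSL ℝ x) x)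
    (hm0 : ∀ x, 0 ≤ m x) (hmx : ∀ x, m x * ‖x‖ ≤ 1) (hmk : ∀ x, 0 ≤ 2 * m x + k x * ‖x‖ ^ 2) :
    ∫ x in ball 0 R, m x * ‖u x‖ ^ 2
      ≤ (∫ x, ‖g x‖ ^ 2 ∂(surfaceMeasure R)) + 2 * ∫ x in ball 0 R, ‖u x‖ * ‖G x‖ := by
  have hmcont := hmc.continuous
  have hball := ae_restrict_ball_norm_le R
  have hderiv : Integrable (fun x => 2 * m x * inner ℝ (u x) (G x x))
      (volume.restrict (ball 0 R)) := by
    have hB := continuous_radialDerivForm (hmcont.const_mul 2)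
    simpa only [radialDerivForm_apply] using
      integrable_bilin_of_continuous hB hball h.memLp_deriv h.memLp_three
  have hkey := h.setIntegral_ball_mul_norm_sq hk hmc hm
  rw [integral_add hderiv (h.integrableOn_mul_norm_sq (by fun_prop))] at hkey
  have hbulk : ∫ x in ball 0 R, m x * ‖u x‖ ^ 2
      ≤ ∫ x in ball 0 R, (3 * m x + k x * ‖x‖ ^ 2) * ‖u x‖ ^ 2 :=
    integral_mono (h.integrableOn_mul_norm_sq hmcont) (h.integrableOn_mul_norm_sq (by fun_prop))
      fun x => mul_le_mul_of_nonneg_right (by linarith [hmk x]) (sq_nonneg _)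
  have hgrad : -(∫ x in ball 0 R, 2 * m x * inner ℝ (u x) (G x x))
      ≤ 2 * ∫ x in ball 0 R, ‖u x‖ * ‖G x‖ := by
    rw [← integral_neg, ← integral_const_mul]
    refine integral_mono hderiv.neg
      ((h.memLp_three.norm.integrable_mul h.memLp_deriv.norm).const_mul 2) fun x => ?_
    calc -(2 * m x * inner ℝ (u x) (G x x)) = 2 * -(m x * inner ℝ (u x) (G x x)) := by ring
      _ ≤ 2 * (‖u x‖ * ‖G x‖) := by
        gcongr
        exact neg_mul_inner_clm_le (hm0 x) (hmx x) (G x) (u x)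
  have hsurface : ∫ x, R * m x * ‖g x‖ ^ 2 ∂(surfaceMeasure R)
      ≤ ∫ x, ‖g x‖ ^ 2 ∂(surfaceMeasure R) := by
    refine integral_mono_ae (integrable_mul_norm_sq (ae_surfaceMeasure_norm_le h.pos)
      (hmcont.const_mul R) h.memLp_trace) h.memLp_trace.norm.integrable_sq ?_
    filter_upwards [ae_surfaceMeasure_norm_eq h.pos] with x hx
    exact mul_le_of_le_one_left (sq_nonneg _) (by simpa only [hx, mul_comm] using hmx x)
  linarith

lemma SmoothApprox.setIntegral_regPow_mul_norm_sq_le (h : SmoothApprox u G R g v) {ε : ℝ}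
    (hε : 0 < ε) : ∫ x in ball 0 R, regPow ε (-1 / 2) x * ‖u x‖ ^ 2
      ≤ (∫ x, ‖g x‖ ^ 2 ∂(surfaceMeasure R)) + 2 * ∫ x in ball 0 R, ‖u x‖ * ‖G x‖ :=
  h.setIntegral_mul_norm_sq_le ((continuous_regPow hε _).const_mul _) (contDiff_regPow hε _)
    (hasFDerivAt_regPow hε _) (fun x => (regPow_pos hε _ x).le)
    (regPow_neg_half_mul_norm_le_one ε) fun x => by
      linarith [regPow_sub_one_mul_norm_sq_le hε (-1 / 2) x, regPow_pos hε (-1 / 2) x]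

lemma integrable_of_tendsto_of_integral_norm_le {X F : Type*} [MeasurableSpace X] {μ : Measure X}
    [NormedAddCommGroup F] {f : ℕ → X → F} {f₀ : X → F} {M : ℝ} (hf : ∀ n, Integrable (f n) μ)
    (hM : ∀ n, ∫ x, ‖f n x‖ ∂μ ≤ M)
    (h : ∀ᵐ x ∂μ, Tendsto (fun n => f n x) atTop (𝓝 (f₀ x))) : Integrable f₀ μ := by
  refine ⟨aestronglyMeasurable_of_tendsto_ae _ (fun n => (hf n).1) h, ?_⟩
  calc ∫⁻ x, ‖f₀ x‖ₑ ∂μ = ∫⁻ x, liminf (fun n => ‖f n x‖ₑ) atTop ∂μ :=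
        lintegral_congr_ae (h.mono fun x hx => hx.enorm.liminf_eq.symm)
    _ ≤ liminf (fun n => ∫⁻ x, ‖f n x‖ₑ ∂μ) atTop :=
        lintegral_liminf_le' fun n => (hf n).1.enorm
    _ ≤ liminf (fun _ : ℕ => ENNReal.ofReal M) atTop := by
        refine liminf_le_liminf (.of_forall fun n => ?_)
        rw [← ofReal_integral_norm_eq_lintegral_enorm (hf n)]
        exact ENNReal.ofReal_le_ofReal (hM n)
    _ = ENNReal.ofReal M := liminf_const _
    _ < ⊤ := ENNReal.ofReal_lt_top

theorem SmoothApprox.integrableOn_norm_sq_div_norm (h : SmoothApprox u G R g v) :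
    IntegrableOn (fun x => ‖u x‖ ^ 2 / ‖x‖) (ball 0 R) := by
  obtain ⟨ε, -, hε, hε0⟩ := exists_seq_strictAnti_tendsto (0 : ℝ)
  refine integrable_of_tendsto_of_integral_norm_le
    (fun n => h.integrableOn_mul_norm_sq (continuous_regPow (hε n) (-1 / 2)))
    (fun n => (integral_congr_ae (.of_forall fun x => ?_)).trans_le
      (h.setIntegral_regPow_mul_norm_sq_le (hε n))) ?_
  · exact Real.norm_of_nonneg (mul_nonneg (regPow_pos (hε n) _ x).le (sq_nonneg _))
  · filter_upwards [Measure.ae_ne _ 0] with x hx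
    have hlim := ((tendsto_regPow (-1 / 2) hx).comp
      (tendsto_nhdsWithin_iff.2 ⟨hε0, .of_forall hε⟩)).mul_const (‖u x‖ ^ 2)
    rwa [show (2 * (-1 / 2) : ℝ) = -1 by norm_num, Real.rpow_neg_one, inv_mul_eq_div] at hlim

lemma SmoothApprox.integrableOn_norm_sq_div_rpow (h : SmoothApprox u G R g v) (hα : α ≤ 1) :
    IntegrableOn (fun x => ‖u x‖ ^ 2 / ‖x‖ ^ α) (ball 0 R) := by
  have hmeas := (h.memLp_two.1.norm.aemeasurable.pow_const 2).div
    (measurable_norm.pow_const α).aemeasurable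
  refine (h.integrableOn_norm_sq_div_norm.const_mul (R ^ (1 - α))).mono'
    hmeas.aestronglyMeasurable ?_
  filter_upwards [Measure.ae_ne _ 0, ae_restrict_ball_norm_le R] with x hx hxR
  have hx0 : 0 < ‖x‖ := norm_pos_iff.2 hx
  calc ‖‖u x‖ ^ 2 / ‖x‖ ^ α‖ = ‖x‖ ^ (1 - α) * (‖u x‖ ^ 2 / ‖x‖) := by
        rw [Real.norm_of_nonneg (by positivity), Real.rpow_sub hx0, Real.rpow_one]
        field_simp
    _ ≤ R ^ (1 - α) * (‖u x‖ ^ 2 / ‖x‖) := by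
        gcongr

lemma SmoothApprox.integrableOn_normalPart_sq_div_rpow (h : SmoothApprox u G R g v)
    (hα : α ≤ 1) : IntegrableOn (fun x => ‖normalPart u x‖ ^ 2 / ‖x‖ ^ α) (ball 0 R) := by
  have hmeas := ((aestronglyMeasurable_normalPart h.memLp_two.1).norm.aemeasurable.pow_const 2).div
    (measurable_norm.pow_const α).aemeasurable
  refine (h.integrableOn_norm_sq_div_rpow hα).mono' hmeas.aestronglyMeasurable
    (.of_forall fun x => ?_)
  rw [Real.norm_of_nonneg (by positivity)]
  gcongr
  exact norm_normalPart_le u x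

end Hardy

section WeightedIdentity

variable {u : E3 → E3} {G : E3 → E3 →L[ℝ] E3} {R α ε : ℝ} {v : ℕ → E3 → E3} {g : E3 → E3}

lemma SmoothApprox.integrableOn_norm_sq (h : SmoothApprox u G R g v) :
    IntegrableOn (fun x => ‖u x‖ ^ 2) (ball 0 R) := h.memLp_two.norm.integrable_sq

lemma SmoothApprox.integrable_surface_normalPart_sq (h : SmoothApprox u G R g v) :
    Integrable (fun x => ‖normalPart g x‖ ^ 2) (surfaceMeasure R) :=
  (h.memLp_trace.of_le (aestronglyMeasurable_normalPart h.memLp_trace.1)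
    (.of_forall fun x => norm_normalPart_le g x)).norm.integrable_sq

lemma SmoothApprox.setIntegral_regDensity (h : SmoothApprox u G R g v)
    (hG : ∀ᵐ x, stressDiv x (G x) (u x) = 0) (hε : 0 < ε) (b : ℝ) :
    ∫ x in ball 0 R, regDensity ε b x (u x)
      = -((R ^ 2 + ε ^ 2) ^ b * (R / 2)
        * ∫ x, (‖tangentialPart g x‖ ^ 2 - ‖normalPart g x‖ ^ 2) ∂(surfaceMeasure R)) := by
  have hR := h.pos
  have hkey := h.setIntegral_ball_of_stressDiv_eq_zero hG
    ((continuous_regPow hε (b - 1)).const_mul (2 * b)) (contDiff_regPow hε b)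
    (hasFDerivAt_regPow hε b)
  refine mul_left_cancel₀ hR.ne' ?_
  rw [← integral_const_mul, ← integral_const_mul, ← integral_neg, ← integral_const_mul]
  refine Eq.trans ?_ (hkey.trans (integral_congr_ae ?_))
  · congr 1 with x
    rw [regDensity]
    ring
  · filter_upwards [ae_surfaceMeasure_norm_eq hR] with x hx
    rw [norm_tangentialPart_sq, norm_normalPart_sq, regPow, hx]
    field_simp
    ring

lemma SmoothApprox.aestronglyMeasurable_regDensity (h : SmoothApprox u G R g v) (hε : 0 < ε)
    (b : ℝ) : AEStronglyMeasurable (fun x => regDensity ε b x (u x))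
      (volume.restrict (ball 0 R)) := by
  have hk := (continuous_regPow hε (b - 1)).const_mul (2 * b)
  have hm := continuous_regPow hε b
  have hQ := continuous_radialForm hk
    (d := fun x => -((2 * b * regPow ε (b - 1) x * ‖x‖ ^ 2 + regPow ε b x) / 2)) (by fun_prop)
  have hint := integrable_bilin_of_continuous hQ (ae_restrict_ball_norm_le R) h.memLp_two
    h.memLp_two
  simp only [radialForm_apply_self, neg_mul, ← sub_eq_add_neg] at hint
  exact hint.1

lemma SmoothApprox.tendsto_setIntegral_regDensity (h : SmoothApprox u G R g v) (hα : α ≤ 1) :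
    Tendsto (fun ε => ∫ x in ball 0 R, regDensity ε (-α / 2) x (u x)) (𝓝[>] 0)
      (𝓝 ((α - 1) / 2 * (∫ x in ball 0 R, ‖u x‖ ^ 2 / ‖x‖ ^ α)
        - α * ∫ x in ball 0 R, ‖normalPart u x‖ ^ 2 / ‖x‖ ^ α)) := by
  have hu := h.integrableOn_norm_sq_div_rpow hα
  have hN := h.integrableOn_normalPart_sq_div_rpow hα
  have hsmall : ∀ᶠ ε in 𝓝[>] (0 : ℝ), ε ∈ Set.Ioc 0 1 := Ioc_mem_nhdsGT one_pos
  rw [← integral_const_mul, ← integral_const_mul,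
    ← integral_sub (hu.const_mul _) (hN.const_mul _)]
  refine tendsto_integral_filter_of_dominated_convergence
    (fun x => (|-α / 2| + 1 / 2) *
      (‖u x‖ ^ 2 / ‖x‖ ^ α + (R ^ 2 + 1) ^ (-α / 2) * ‖u x‖ ^ 2)) ?_ ?_ ?_ ?_
  · filter_upwards [hsmall] with ε hε using h.aestronglyMeasurable_regDensity hε.1 _
  · filter_upwards [hsmall] with ε hε
    filter_upwards [Measure.ae_ne _ 0, ae_restrict_ball_norm_le R] with x hx hxR
    refine (abs_regDensity_le hε.1 _ x (u x)).trans ?_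
    rw [div_eq_inv_mul (‖u x‖ ^ 2), ← Real.rpow_neg (norm_nonneg x), ← add_mul]
    gcongr
    have hle := regPow_le_add (b := -α / 2) hε.1.le hε.2 hx hxR
    rwa [mul_div_cancel₀ _ two_ne_zero] at hle
  · exact (hu.add (h.integrableOn_norm_sq.const_mul _)).const_mul _
  · filter_upwards [Measure.ae_ne _ 0] with x hx using tendsto_regDensity u hx α

theorem SmoothApprox.weighted_identity (h : SmoothApprox u G R g v)
    (hG : ∀ᵐ x, stressDiv x (G x) (u x) = 0) (hα : α ≤ 1) :
    α * (∫ x in ball 0 R, ‖normalPart u x‖ ^ 2 / ‖x‖ ^ α)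
        + (1 - α) / 2 * (∫ x in ball 0 R, ‖u x‖ ^ 2 / ‖x‖ ^ α)
      = R / (2 * R ^ α)
        * ∫ x, (‖tangentialPart g x‖ ^ 2 - ‖normalPart g x‖ ^ 2) ∂(surfaceMeasure R) := by
  have hR := h.pos
  set J := ∫ x, (‖tangentialPart g x‖ ^ 2 - ‖normalPart g x‖ ^ 2) ∂(surfaceMeasure R)
  have hne : R ^ 2 + (0 : ℝ) ^ 2 ≠ 0 := by simpa using hR.ne'
  have hcont : ContinuousAt (fun ε : ℝ => (R ^ 2 + ε ^ 2) ^ (-α / 2)) 0 :=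
    ContinuousAt.rpow_const (by fun_prop) (Or.inl hne)
  have heq : ∀ᶠ ε in 𝓝[>] (0 : ℝ), -((R ^ 2 + ε ^ 2) ^ (-α / 2) * (R / 2) * J)
      = ∫ x in ball 0 R, regDensity ε (-α / 2) x (u x) := by
    filter_upwards [self_mem_nhdsWithin] with ε hε
    exact (h.setIntegral_regDensity hG hε _).symm
  have hlim := (((hcont.mul_const (R / 2)).mul_const J).tendsto.mono_left
    nhdsWithin_le_nhds).neg.congr' heq
  have hbulk := tendsto_nhds_unique (h.tendsto_setIntegral_regDensity hα) hlim
  rw [zero_pow two_ne_zero, add_zero, ← Real.rpow_two, ← Real.rpow_mul hR.le,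
    mul_div_cancel₀ _ two_ne_zero, Real.rpow_neg hR.le] at hbulk
  linear_combination -hbulk

lemma integral_surfaceMeasure_div_norm_rpow (hR : 0 < R) (f : E3 → ℝ) (α : ℝ) :
    ∫ x, f x / ‖x‖ ^ α ∂(surfaceMeasure R) = (∫ x, f x ∂(surfaceMeasure R)) / R ^ α := by
  rw [← integral_div]
  refine integral_congr_ae ?_
  filter_upwards [ae_surfaceMeasure_norm_eq hR] with x hx
  rw [hx]

theorem SmoothApprox.power_weight_identity (h : SmoothApprox u G R g v)
    (hG : ∀ᵐ x, stressDiv x (G x) (u x) = 0) (hα : α ≤ 1) :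
    (α - 1) / 2 * (∫ x in ball 0 R, ‖u x‖ ^ 2 / ‖x‖ ^ α)
        + R / 2 * (∫ x, ‖g x‖ ^ 2 / ‖x‖ ^ α ∂(surfaceMeasure R))
      = α * (∫ x in ball 0 R, ‖normalPart u x‖ ^ 2 / ‖x‖ ^ α)
        + R * (∫ x, ‖normalPart g x‖ ^ 2 / ‖x‖ ^ α ∂(surfaceMeasure R)) := by
  have hid := h.weighted_identity hG hα
  have hsplit : ∫ x, (‖tangentialPart g x‖ ^ 2 - ‖normalPart g x‖ ^ 2) ∂(surfaceMeasure R)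
      = (∫ x, ‖g x‖ ^ 2 ∂(surfaceMeasure R))
        - 2 * ∫ x, ‖normalPart g x‖ ^ 2 ∂(surfaceMeasure R) := by
    rw [← integral_const_mul, ← integral_sub h.memLp_trace.norm.integrable_sq
      (h.integrable_surface_normalPart_sq.const_mul 2)]
    congr 1 with x
    rw [norm_tangentialPart_sq]
    ring
  rw [integral_surfaceMeasure_div_norm_rpow h.pos, integral_surfaceMeasure_div_norm_rpow h.pos]
  linear_combination -hid - R / (2 * R ^ α) * hsplit

lemma norm_mul_norm_tangentialPart_sq (u : E3 → E3) (x : E3) :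
    ‖x‖ * ‖tangentialPart u x‖ ^ 2
      = ‖u x‖ ^ 2 / ‖x‖ ^ (-1 : ℝ) - ‖normalPart u x‖ ^ 2 / ‖x‖ ^ (-1 : ℝ) := by
  rw [norm_tangentialPart_sq, Real.rpow_neg_one, div_inv_eq_mul, div_inv_eq_mul]
  ring

lemma SmoothApprox.integrableOn_norm_mul_tangentialPart_sq (h : SmoothApprox u G R g v) :
    IntegrableOn (fun x => ‖x‖ * ‖tangentialPart u x‖ ^ 2) (ball 0 R) := by
  simp only [norm_mul_norm_tangentialPart_sq]
  exact (h.integrableOn_norm_sq_div_rpow (by norm_num)).sub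
    (h.integrableOn_normalPart_sq_div_rpow (by norm_num))

lemma SmoothApprox.setIntegral_normalPart_sq_div_norm (h : SmoothApprox u G R g v)
    (hG : ∀ᵐ x, stressDiv x (G x) (u x) = 0) :
    ∫ x in ball 0 R, ‖normalPart u x‖ ^ 2 / ‖x‖
      = 1 / 2 * ∫ x, (‖tangentialPart g x‖ ^ 2 - ‖normalPart g x‖ ^ 2) ∂(surfaceMeasure R) := by
  have hid := h.weighted_identity hG le_rfl
  have hR := h.pos.ne'
  simp only [Real.rpow_one] at hid
  field_simp at hid ⊢
  linear_combination hid

lemma SmoothApprox.setIntegral_norm_sq (h : SmoothApprox u G R g v)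
    (hG : ∀ᵐ x, stressDiv x (G x) (u x) = 0) :
    ∫ x in ball 0 R, ‖u x‖ ^ 2
      = R * ∫ x, (‖tangentialPart g x‖ ^ 2 - ‖normalPart g x‖ ^ 2) ∂(surfaceMeasure R) := by
  have hid := h.weighted_identity hG zero_le_one
  simp only [Real.rpow_zero, div_one] at hid
  linear_combination 2 * hid

lemma SmoothApprox.setIntegral_norm_mul_tangentialPart_sq (h : SmoothApprox u G R g v)
    (hG : ∀ᵐ x, stressDiv x (G x) (u x) = 0) :
    ∫ x in ball 0 R, ‖x‖ * ‖tangentialPart u x‖ ^ 2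
      = R ^ 2 / 2
        * ∫ x, (‖tangentialPart g x‖ ^ 2 - ‖normalPart g x‖ ^ 2) ∂(surfaceMeasure R) := by
  have hα : (-1 : ℝ) ≤ 1 := by norm_num
  have hid := h.weighted_identity hG hα
  simp only [norm_mul_norm_tangentialPart_sq]
  rw [integral_sub (h.integrableOn_norm_sq_div_rpow hα) (h.integrableOn_normalPart_sq_div_rpow hα)]
  rw [Real.rpow_neg_one, mul_comm 2, ← div_div, div_inv_eq_mul] at hid
  linear_combination hid

theorem SmoothApprox.equal_weighted_integrals (h : SmoothApprox u G R g v)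
    (hG : ∀ᵐ x, stressDiv x (G x) (u x) = 0) :
    (∫ x in ball 0 R, ‖normalPart u x‖ ^ 2 / ‖x‖)
        = 1 / R ^ 2 * (∫ x in ball 0 R, ‖x‖ * ‖tangentialPart u x‖ ^ 2) ∧
      1 / R ^ 2 * (∫ x in ball 0 R, ‖x‖ * ‖tangentialPart u x‖ ^ 2)
        = 1 / (2 * R) * (∫ x in ball 0 R, ‖u x‖ ^ 2) ∧
      1 / (2 * R) * (∫ x in ball 0 R, ‖u x‖ ^ 2)
        = 1 / 2 * (∫ x, (‖tangentialPart g x‖ ^ 2 - ‖normalPart g x‖ ^ 2)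
            ∂(surfaceMeasure R)) := by
  have hR := h.pos.ne'
  rw [h.setIntegral_normalPart_sq_div_norm hG, h.setIntegral_norm_mul_tangentialPart_sq hG,
    h.setIntegral_norm_sq hG]
  refine ⟨?_, ?_, ?_⟩ <;> field_simp

end WeightedIdentity

end Beltrami

end

theorem lemma2 (α : ℝ) (hα : α ≤ 1) (u : E3 → E3) (hu : Beltrami.IsWeakBeltramiFlow u)
    (R : ℝ) (hR : 0 < R) :
    -- the boundary values of `u` on the sphere exist, as a trace
    (∃ g : E3 → E3, Beltrami.IsSphereTrace (3 / 2) u R g) ∧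
    -- they are square integrable, and the identities hold for them
    ∀ g : E3 → E3, Beltrami.IsSphereTrace (3 / 2) u R g →
      MemLp g 2 (Beltrami.surfaceMeasure R) ∧
      IntegrableOn (fun x => ‖u x‖ ^ 2 / ‖x‖ ^ α) (ball 0 R) ∧
      IntegrableOn (fun x => ‖Beltrami.normalPart u x‖ ^ 2 / ‖x‖ ^ α) (ball 0 R) ∧
      (α - 1) / 2 * (∫ x in ball 0 R, ‖u x‖ ^ 2 / ‖x‖ ^ α)
          + R / 2 * (∫ x, ‖g x‖ ^ 2 / ‖x‖ ^ α ∂(Beltrami.surfaceMeasure R))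
        = α * (∫ x in ball 0 R, ‖Beltrami.normalPart u x‖ ^ 2 / ‖x‖ ^ α)
          + R * (∫ x, ‖Beltrami.normalPart g x‖ ^ 2 / ‖x‖ ^ α ∂(Beltrami.surfaceMeasure R)) ∧
      (α = 1 →
        IntegrableOn (fun x => ‖x‖ * ‖Beltrami.tangentialPart u x‖ ^ 2) (ball 0 R) ∧
        IntegrableOn (fun x => ‖u x‖ ^ 2) (ball 0 R) ∧
        (∫ x in ball 0 R, ‖Beltrami.normalPart u x‖ ^ 2 / ‖x‖)
          = 1 / R ^ 2 * (∫ x in ball 0 R, ‖x‖ * ‖Beltrami.tangentialPart u x‖ ^ 2) ∧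
        1 / R ^ 2 * (∫ x in ball 0 R, ‖x‖ * ‖Beltrami.tangentialPart u x‖ ^ 2)
          = 1 / (2 * R) * (∫ x in ball 0 R, ‖u x‖ ^ 2) ∧
        1 / (2 * R) * (∫ x in ball 0 R, ‖u x‖ ^ 2)
          = 1 / 2 * (∫ x, (‖Beltrami.tangentialPart g x‖ ^ 2 - ‖Beltrami.normalPart g x‖ ^ 2)
              ∂(Beltrami.surfaceMeasure R))) := by
  obtain ⟨G, hW, hu1, hG1, hcurl, hdiv⟩ := hu
  have hstress : ∀ᵐ x, Beltrami.stressDiv x (G x) (u x) = 0 := by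
    filter_upwards [hcurl, hdiv] with x hx1 hx2 using Beltrami.stressDiv_eq_zero hx2 hx1
  obtain ⟨g₀, v, h₀⟩ := Beltrami.exists_smoothApprox hW hu1 hG1 hR
  refine ⟨⟨g₀, h₀.isSphereTrace hW⟩, fun g hg => ?_⟩
  have h := h₀.congr_trace ((h₀.isSphereTrace hW).ae_eq hg Beltrami.one_le_three_halves
    Beltrami.one_le_three_halves hR)
  exact ⟨h.memLp_trace, h.integrableOn_norm_sq_div_rpow hα,
    h.integrableOn_normalPart_sq_div_rpow hα, h.power_weight_identity hstress hα,
    fun _ => ⟨h.integrableOn_norm_mul_tangentialPart_sq, h.integrableOn_norm_sq,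
      h.equal_weighted_integrals hstress⟩⟩
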